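/- A normed arithmetic semigroup $\mathcal S$ is a commutative semigroup with identity $1$, whose only unit is $1$, in which every element factors uniquely (up to order) into prime elements, equipped with a nonnegative multiplicative norm $s\mapsto|s|$ such that for every real $x$ only finitely many elements satisfy $|s|\le x$. Let $\nu_{\mathcal S}(x)$ be the number of elements $s$ with $|s|\le x$, and $\pi_{\mathcal S}(x)$ the number of primes $\mathfrak p$ with $|\mathfrak p|\le x$. Consider the conditions, as $x\to\infty$: (a) for some constants $A,\delta>0$, $\ \nu_{\mathcal S}(x)=Ax\left(1+O(x^{-\delta})\right)$; (b) for some constants $\theta,\epsilon>0$, $\ \pi_{\mathcal S}(x)=\theta\,\dfrac{x}{\log x}\left(1+O\big((\log x)^{-\epsilon}\big)\right)$. For an integer $n>1$ let $s$ be chosen uniformly from the elements of $\mathcal S$ with norm not exceeding $n$, and let $s=\mathfrak p_1\mathfrak p_2\cdots\mathfrak p_{\Omega(s)}$ be its decomposition into prime factors, with multiplicity, ordered so that $|\mathfrak p_1|\ge|\mathfrak p_2|\ge\cdots$. Put $L_i(n)=\log|\mathfrak p_i|/\log n$ for $i\le\Omega(s)$ and $L_i(n)=0$ for $i>\Omega(s)$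 (so $L_i(n)=0$ for all $i$ if $s=1$). For $\theta>0$ let $PD(\theta)$ be the Poisson–Dirichlet distribution: the law on $\mathbb R^{\mathbb N}$ of the sequence obtained by sorting into decreasing order the numbers $G_i=V_1\cdots V_{i-1}(1-V_i)$, $i\ge1$, where $V_i=U_i^{1/\theta}$ and $U_1,U_2,\dots$ are independent and uniform on $(0,1)$. **Theorem.** Let $\mathcal S$ be a normed arithmetic semigroup. If (a) holds, then, as $n\to\infty$, $(L_1(n),L_2(n),\dots)$ converges in distribution in $\mathbb R^{\mathbb N}$ (with the product topology) to $PD(1)$. If (b) holds, then, as $n\to\infty$, $(L_1(n),L_2(n),\dots)$ converges in distribution in $\mathbb R^{\mathbb N}$ to $PD(\theta)$, with the same $\theta$ as in (b). -/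

import Mathlib

open Filter Topology MeasureTheory Asymptotics

/-- A normed arithmetic semigroup: a commutative semigroup with identity `1`, whose only unit is
`1`, with unique factorization into prime elements (the free generators, which are exactly the
irreducible elements), and with a nonnegative multiplicative norm such that there are only
finitely many elements of bounded norm. -/
class NormedArithmeticSemigroup (S : Type*) extends CommMonoid S where
  /-- the norm `|s|` -/
  nrm : S → ℝ
  eq_one_of_isUnit : ∀ u : S, IsUnit u → u = 1
  existsUnique_factors : ∀ s : S, ∃! m : Multiset S, (∀ p ∈ m, Irreducible p) ∧ m.prod = s
  nrm_nonneg : ∀ s : S, 0 ≤ nrm s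
  nrm_mul : ∀ s t : S, nrm (s * t) = nrm s * nrm t
  finite_nrm_le : ∀ x : ℝ, {s : S | nrm s ≤ x}.Finite

namespace NormedArithmeticSemigroup

/-- `ν_S(x)`, the number of elements of norm at most `x`. -/
noncomputable def elementCount (S : Type*) [NormedArithmeticSemigroup S] (x : ℝ) : ℕ :=
  {s : S | nrm s ≤ x}.ncard

/-- `π_S(x)`, the number of primes of norm at most `x`. -/
noncomputable def primeCount (S : Type*) [NormedArithmeticSemigroup S] (x : ℝ) : ℕ :=
  {p : S | Irreducible p ∧ nrm p ≤ x}.ncard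

/-- `ν_S(x) = A x (1 + O(x^{-δ}))` as `x → ∞`, for some positive constants `A` and `δ`. -/
def LinearGrowth (S : Type*) [NormedArithmeticSemigroup S] : Prop :=
  ∃ A δ : ℝ, 0 < A ∧ 0 < δ ∧ ∃ E : ℝ → ℝ, (E =O[atTop] fun x : ℝ => x ^ (-δ)) ∧
    ∀ᶠ x : ℝ in atTop, (elementCount S x : ℝ) = A * x * (1 + E x)

/-- `π_S(x) = θ (x / log x) (1 + O((log x)^{-ε}))` as `x → ∞`, for some `ε > 0`. -/
def PrimeGrowth (S : Type*) [NormedArithmeticSemigroup S] (θ : ℝ) : Prop :=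
  ∃ ε : ℝ, 0 < ε ∧ ∃ E : ℝ → ℝ, (E =O[atTop] fun x : ℝ => Real.log x ^ (-ε)) ∧
    ∀ᶠ x : ℝ in atTop, (primeCount S x : ℝ) = θ * (x / Real.log x) * (1 + E x)

variable {S : Type*} [NormedArithmeticSemigroup S]

/-- The multiset of prime factors of `s`, with multiplicities. -/
noncomputable def primeFactors (s : S) : Multiset S :=
  (existsUnique_factors s).choose

/-- The norms of the prime factors of `s`, with multiplicities, in decreasing order. -/
noncomputable def factorNorms (s : S) : List ℝ :=
  ((primeFactors s).map nrm).sort (· ≥ ·)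

/-- The sequence `L(n)` at `s`: its coordinates (numbered from `0`) are the numbers
`log |p_i| / log n`, followed by zeros. -/
noncomputable def scaledLogFactors (n : ℕ) (s : S) : ℕ → ℝ := fun i =>
  ((factorNorms s).map fun x => Real.log x / Real.log n).getD i 0

theorem one_mem_nrm_le (n : ℕ) (hn : 1 < n) : (1 : S) ∈ (finite_nrm_le (S := S) n).toFinset := by
  have h : nrm (1 : S) = nrm (1 : S) * nrm (1 : S) := by rw [← nrm_mul, one_mul]
  have hn' : (1 : ℝ) < n := by exact_mod_cast hn
  simp only [Set.Finite.mem_toFinset, Set.mem_ofPred_eq]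
  nlinarith [nrm_nonneg (1 : S)]

/-- The law of `L(n)`, as a probability measure on `ℝ^ℕ`, when `s` is uniform among the elements
of `S` of norm at most `n`. -/
noncomputable def scaledLogFactorsLaw (S : Type*) [NormedArithmeticSemigroup S]
    (n : Set.Ioi (1 : ℕ)) : ProbabilityMeasure (ℕ → ℝ) :=
  ⟨((PMF.uniformOfFinset (finite_nrm_le (S := S) (n : ℕ)).toFinset
      ⟨1, one_mem_nrm_le n n.2⟩).map (scaledLogFactors n)).toMeasure, inferInstance⟩

end NormedArithmeticSemigroup

namespace PoissonDirichlet

/-- The uniform distribution on `(0, 1)`. -/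
noncomputable def uniform : Measure ℝ := volume.restrict (Set.Ioo 0 1)

instance : IsProbabilityMeasure uniform := ⟨by simp [uniform]⟩

/-- The law of a sequence of independent uniforms on `(0, 1)`. -/
noncomputable def iidUniform : ProbabilityMeasure (ℕ → ℝ) :=
  ⟨Measure.infinitePi fun _ : ℕ => uniform, inferInstance⟩

/-- With `V_i = U_i^{1/θ}`, the sequence `G_i = V_1 ⋯ V_{i-1} (1 - V_i)`. -/
noncomputable def stickBreaking (θ : ℝ) (u : ℕ → ℝ) : ℕ → ℝ := fun i =>
  (∏ j ∈ Finset.range i, u j ^ (1 / θ)) * (1 - u i ^ (1 / θ))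

/-- The decreasing rearrangement of a sequence of nonnegative numbers tending to zero: the
`(k+1)`-st largest term, counting multiplicities, is the largest possible value of the minimum of
`k+1` terms with distinct indices. -/
noncomputable def ranked (g : ℕ → ℝ) : ℕ → ℝ := fun k =>
  ⨆ F : {F : Finset ℕ // F.card = k + 1},
    F.1.inf' (Finset.card_pos.mp (by rw [F.2]; exact k.succ_pos)) g

theorem measurable_stickBreaking (θ : ℝ) : Measurable (stickBreaking θ) := by
  unfold stickBreaking
  fun_prop

theorem measurable_ranked : Measurable ranked := by
  refine measurable_pi_lambda _ fun k => Measurable.iSup fun F => ?_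
  generalize_proofs hF
  have h : (fun g : ℕ → ℝ => F.1.inf' hF g) = F.1.inf' hF fun i (g : ℕ → ℝ) => g i := by
    ext g
    simp [Finset.inf'_apply]
  change Measurable fun g : ℕ → ℝ => F.1.inf' hF g
  rw [h]
  exact Finset.inf'_induction hF (p := fun f : (ℕ → ℝ) → ℝ => Measurable f) _
    (fun _ h₁ _ h₂ => h₁.inf h₂) fun i _ => measurable_pi_apply i

/-- The Poisson-Dirichlet distribution `PD(θ)`, for `θ > 0`: the law, on `ℝ^ℕ`, of the ranked
stick-breaking sequence. -/
noncomputable def PD (θ : ℝ) : ProbabilityMeasure (ℕ → ℝ) :=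
  iidUniform.map (f := fun u => ranked (stickBreaking θ u))
    (measurable_ranked.comp (measurable_stickBreaking θ)).aemeasurable

end PoissonDirichlet

namespace NormedArithmeticSemigroup

noncomputable section

open scoped Classical

variable {S : Type*} [NormedArithmeticSemigroup S]

theorem irreducible_of_mem_primeFactors {s p : S} (hp : p ∈ primeFactors s) : Irreducible p :=
  (existsUnique_factors s).choose_spec.1.1 p hp

theorem prod_primeFactors (s : S) : (primeFactors s).prod = s :=
  (existsUnique_factors s).choose_spec.1.2

theorem primeFactors_eq {s : S} {m : Multiset S} (hm : ∀ p ∈ m, Irreducible p)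
    (hs : m.prod = s) : primeFactors s = m :=
  ((existsUnique_factors s).choose_spec.2 m ⟨hm, hs⟩).symm

theorem primeFactors_mul (s t : S) : primeFactors (s * t) = primeFactors s + primeFactors t := by
  refine primeFactors_eq (fun p hp => ?_) (by simp [prod_primeFactors])
  rcases Multiset.mem_add.1 hp with h | h <;> exact irreducible_of_mem_primeFactors h

theorem primeFactors_prime {p : S} (hp : Irreducible p) : primeFactors p = {p} :=
  primeFactors_eq (by simpa using hp) (by simp)

theorem primeFactors_one : primeFactors (1 : S) = 0 := primeFactors_eq (by simp) (by simp)

theorem primeFactors_pow (s : S) (k : ℕ) : primeFactors (s ^ k) = k • primeFactors s := by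
  induction k with
  | zero => simp [primeFactors_one]
  | succ k ih => rw [pow_succ, primeFactors_mul, ih, succ_nsmul]

theorem primeFactors_injective : Function.Injective (primeFactors (S := S)) := fun s t h => by
  rw [← prod_primeFactors s, h, prod_primeFactors]

theorem mul_left_injective' (s : S) : Function.Injective (s * ·) := fun t t' h => by
  apply primeFactors_injective
  have := congrArg primeFactors h
  simpa [primeFactors_mul] using this

theorem dvd_iff_primeFactors_le {s t : S} : s ∣ t ↔ primeFactors s ≤ primeFactors t := by
  constructor
  · rintro ⟨r, rfl⟩
    rw [primeFactors_mul]
    exact Multiset.le_add_right _ _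
  · intro h
    obtain ⟨u, hu⟩ := Multiset.le_iff_exists_add.1 h
    refine ⟨u.prod, ?_⟩
    rw [← prod_primeFactors t, hu, Multiset.prod_add, prod_primeFactors]

theorem pow_prime_injective {p : S} (hp : Irreducible p) : Function.Injective (p ^ · : ℕ → S) :=
  fun j k h => by
    have := congrArg primeFactors h
    simp only [primeFactors_pow, primeFactors_prime hp] at this
    simpa using congrArg Multiset.card this

theorem nrm_pow_succ (s : S) (k : ℕ) : nrm (s ^ (k + 1)) = nrm s ^ (k + 1) := by
  induction k with
  | zero => simp
  | succ k ih => rw [pow_succ, nrm_mul, ih, ← pow_succ]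

theorem one_lt_nrm_prime {p : S} (hp : Irreducible p) : 1 < nrm p := by
  by_contra! h
  refine Set.infinite_range_of_injective
    ((pow_prime_injective hp).comp (add_left_injective 1)) ((finite_nrm_le (S := S) 1).subset ?_)
  rintro _ ⟨k, rfl⟩
  simp only [Function.comp, Set.mem_ofPred_eq, nrm_pow_succ]
  exact pow_le_one₀ (nrm_nonneg p) h

theorem nrm_one_eq_zero_or_one : nrm (1 : S) = 0 ∨ nrm (1 : S) = 1 := by
  have h : nrm (1 : S) = nrm (1 : S) * nrm (1 : S) := by rw [← nrm_mul, one_mul]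
  by_cases h0 : nrm (1 : S) = 0
  · exact Or.inl h0
  · exact Or.inr (mul_left_cancel₀ h0 (by linarith))

/-- `log |s|`. -/
def logNorm (s : S) : ℝ := Real.log (nrm s)

theorem one_le_nrm (h1 : nrm (1 : S) = 1) (s : S) : 1 ≤ nrm s := by
  rw [← prod_primeFactors s]
  have : ∀ m : Multiset S, (∀ p ∈ m, Irreducible p) → 1 ≤ nrm m.prod := by
    intro m
    induction m using Multiset.induction with
    | empty => simp [h1]
    | cons a m ih =>
      intro h
      rw [Multiset.prod_cons, nrm_mul]
      exact one_le_mul_of_one_le_of_one_le (one_lt_nrm_prime (h a (by simp))).le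
        (ih fun p hp => h p (by simp [hp]))
  exact this _ fun p hp => irreducible_of_mem_primeFactors hp

theorem logNorm_nonneg (h1 : nrm (1 : S) = 1) (s : S) : 0 ≤ logNorm s :=
  Real.log_nonneg (one_le_nrm h1 s)

theorem logNorm_one (h1 : nrm (1 : S) = 1) : logNorm (1 : S) = 0 := by simp [logNorm, h1]

theorem logNorm_mul (h1 : nrm (1 : S) = 1) (s t : S) :
    logNorm (s * t) = logNorm s + logNorm t := by
  have hs := one_le_nrm h1 s
  have ht := one_le_nrm h1 t
  rw [logNorm, nrm_mul, Real.log_mul (by positivity) (by positivity)]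
  rfl

theorem logNorm_prime_pos {p : S} (hp : Irreducible p) : 0 < logNorm p :=
  Real.log_pos (one_lt_nrm_prime hp)

theorem logNorm_pow (h1 : nrm (1 : S) = 1) (s : S) (k : ℕ) :
    logNorm (s ^ k) = k * logNorm s := by
  induction k with
  | zero => simp [logNorm_one h1]
  | succ k ih => rw [pow_succ, logNorm_mul h1, ih]; push_cast; ring

theorem logNorm_eq_sum (h1 : nrm (1 : S) = 1) (s : S) :
    logNorm s = ((primeFactors s).map logNorm).sum := by
  have : ∀ m : Multiset S, logNorm m.prod = (m.map logNorm).sum := by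
    intro m
    induction m using Multiset.induction with
    | empty => simp [logNorm_one h1]
    | cons a m ih => rw [Multiset.prod_cons, logNorm_mul h1, ih]; simp
  rw [← this, prod_primeFactors]

theorem finite_logNorm_le (y : ℝ) : {s : S | logNorm s ≤ y}.Finite := by
  refine (finite_nrm_le (S := S) (Real.exp y)).subset fun s hs => ?_
  simp only [Set.mem_ofPred_eq, logNorm] at hs ⊢
  rcases (nrm_nonneg s).eq_or_lt with h | h
  · rw [← h]; positivity
  · exact (Real.log_le_iff_le_exp h).1 hs

/-- The elements `s` with `log |s| ≤ y`. -/
def ball (S : Type*) [NormedArithmeticSemigroup S] (y : ℝ) : Finset S :=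
  (finite_logNorm_le (S := S) y).toFinset

@[simp]
theorem mem_ball {y : ℝ} {s : S} : s ∈ ball S y ↔ logNorm s ≤ y := by simp [ball]

theorem ball_mono {y z : ℝ} (h : y ≤ z) : ball S y ⊆ ball S z := fun _ hs =>
  mem_ball.2 ((mem_ball.1 hs).trans h)

/-- The primes `p` with `log |p| ≤ y`. -/
def primeBall (S : Type*) [NormedArithmeticSemigroup S] (y : ℝ) : Finset S :=
  (ball S y).filter Irreducible

@[simp]
theorem mem_primeBall {y : ℝ} {p : S} : p ∈ primeBall S y ↔ logNorm p ≤ y ∧ Irreducible p := by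
  simp [primeBall]

theorem primeBall_mono {y z : ℝ} (h : y ≤ z) : primeBall S y ⊆ primeBall S z := fun _ hs =>
  mem_primeBall.2 ⟨(mem_primeBall.1 hs).1.trans h, (mem_primeBall.1 hs).2⟩

/-- The von Mangoldt function: `log |p|` at powers of a prime `p`, zero elsewhere. -/
def vonMangoldt (d : S) : ℝ :=
  if h : ∃ p : S, Irreducible p ∧ ∃ k : ℕ, d = p ^ (k + 1) then logNorm h.choose else 0

theorem eq_of_prime_pow_eq {p q : S} (hp : Irreducible p) (hq : Irreducible q) {j k : ℕ}
    (h : p ^ (j + 1) = q ^ (k + 1)) : p = q := by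
  have := congrArg primeFactors h
  rw [primeFactors_pow, primeFactors_pow, primeFactors_prime hp, primeFactors_prime hq] at this
  have hm : p ∈ (k + 1) • ({q} : Multiset S) := by rw [← this]; simp
  simpa using hm

theorem vonMangoldt_pow {p : S} (hp : Irreducible p) (k : ℕ) :
    vonMangoldt (p ^ (k + 1)) = logNorm p := by
  have h : ∃ q : S, Irreducible q ∧ ∃ j : ℕ, p ^ (k + 1) = q ^ (j + 1) := ⟨p, hp, k, rfl⟩
  rw [vonMangoldt, dif_pos h]
  obtain ⟨hq, j, hj⟩ := h.choose_spec
  rw [← eq_of_prime_pow_eq hp hq hj]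

theorem vonMangoldt_nonneg (d : S) : 0 ≤ vonMangoldt d := by
  unfold vonMangoldt
  split_ifs with h
  · exact (logNorm_prime_pos h.choose_spec.1).le
  · exact le_rfl

theorem sum_vonMangoldt_mul (h1 : nrm (1 : S) = 1) (y : ℝ) (F : S → ℝ) :
    ∑ d ∈ ball S y, vonMangoldt d * F d =
      ∑ p ∈ primeBall S y, ∑ k ∈ Finset.range ⌊y / logNorm p⌋₊, logNorm p * F (p ^ (k + 1)) := by
  have key : ∀ p : S, Irreducible p → ∀ k : ℕ,
      (k < ⌊y / logNorm p⌋₊ ↔ logNorm (p ^ (k + 1)) ≤ y) := by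
    intro p hp k
    rw [logNorm_pow h1, ← le_div_iff₀ (logNorm_prime_pos hp), ← Nat.succ_le_iff,
      Nat.le_floor_iff' (Nat.succ_ne_zero k)]
  rw [Finset.sum_sigma']
  symm
  refine Finset.sum_bij_ne_zero (fun x _ _ => x.1 ^ (x.2 + 1)) ?_ ?_ ?_ ?_
  · rintro ⟨p, k⟩ h _
    simp only [Finset.mem_sigma, mem_primeBall, Finset.mem_range] at h
    exact mem_ball.2 ((key p h.1.2 k).1 h.2)
  · rintro ⟨p, k⟩ h _ ⟨q, j⟩ h' _ he
    simp only [Finset.mem_sigma, mem_primeBall, Finset.mem_range] at h h' he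
    obtain rfl := eq_of_prime_pow_eq h.1.2 h'.1.2 he
    have := pow_prime_injective h.1.2 he
    simp only [add_left_inj] at this
    rw [this]
  · intro d hd hne
    have hL : vonMangoldt d ≠ 0 := left_ne_zero_of_mul hne
    by_cases h : ∃ p : S, Irreducible p ∧ ∃ k : ℕ, d = p ^ (k + 1)
    · obtain ⟨p, hp, k, rfl⟩ := h
      have hk := mem_ball.1 hd
      have hpy : logNorm p ≤ y := by
        rw [logNorm_pow h1] at hk
        have := logNorm_prime_pos hp
        push_cast at hk
        nlinarith [mul_nonneg (Nat.cast_nonneg (α := ℝ) k) this.le]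
      refine ⟨⟨p, k⟩, ?_, ?_, rfl⟩
      · simp only [Finset.mem_sigma, mem_primeBall, Finset.mem_range]
        exact ⟨⟨hpy, hp⟩, (key p hp k).2 hk⟩
      · rwa [← vonMangoldt_pow hp k]
    · exact absurd (dif_neg h) hL
  · rintro ⟨p, k⟩ h _
    simp only [Finset.mem_sigma, mem_primeBall, Finset.mem_range] at h
    rw [vonMangoldt_pow h.1.2]

theorem sum_vonMangoldt_dvd (h1 : nrm (1 : S) = 1) {y : ℝ} {s : S} (hs : s ∈ ball S y) :
    ∑ d ∈ ball S y, vonMangoldt d * (if d ∣ s then 1 else 0) = logNorm s := by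
  have hmem : ∀ p ∈ primeFactors s, logNorm p ≤ logNorm s := by
    intro p hp
    rw [logNorm_eq_sum h1 s]
    exact Multiset.single_le_sum (by simp [logNorm_nonneg h1]) _ (Multiset.mem_map_of_mem _ hp)
  rw [sum_vonMangoldt_mul h1, logNorm_eq_sum h1 s, Finset.sum_multiset_map_count]
  have hsub : (primeFactors s).toFinset ⊆ primeBall S y := fun p hp => by
    rw [Multiset.mem_toFinset] at hp
    exact mem_primeBall.2
      ⟨(hmem p hp).trans (mem_ball.1 hs), irreducible_of_mem_primeFactors hp⟩
  have hdvd : ∀ p : S, Irreducible p → ∀ k : ℕ,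
      (p ^ (k + 1) ∣ s ↔ k < (primeFactors s).count p) := by
    intro p hp k
    rw [dvd_iff_primeFactors_le, primeFactors_pow, primeFactors_prime hp,
      Multiset.nsmul_singleton, ← Multiset.le_count_iff_replicate_le, Nat.succ_le_iff]
  have hinner : ∀ p ∈ primeBall S y,
      ∑ k ∈ Finset.range ⌊y / logNorm p⌋₊, logNorm p * (if p ^ (k + 1) ∣ s then 1 else 0) =
        (primeFactors s).count p • logNorm p := by
    intro p hp
    obtain ⟨-, hp⟩ := mem_primeBall.1 hp
    have hle : (primeFactors s).count p ≤ ⌊y / logNorm p⌋₊ := by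
      rw [Nat.le_floor_iff (div_nonneg ((logNorm_nonneg h1 s).trans (mem_ball.1 hs))
        (logNorm_prime_pos hp).le), le_div_iff₀ (logNorm_prime_pos hp), ← logNorm_pow h1]
      refine le_trans ?_ (mem_ball.1 hs)
      rcases Nat.eq_zero_or_pos ((primeFactors s).count p) with h | h
      · rw [h, pow_zero, logNorm_one h1]; exact logNorm_nonneg h1 s
      · obtain ⟨k, hk⟩ := Nat.exists_eq_add_of_lt h
        obtain ⟨t, ht⟩ := (hdvd p hp k).2 (by omega)
        have := congrArg logNorm ht
        rw [logNorm_mul h1] at this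
        rw [hk, zero_add]
        linarith [logNorm_nonneg h1 t]
    simp_rw [hdvd p hp, mul_ite, mul_one, mul_zero]
    rw [← Finset.sum_filter, Finset.sum_const]
    congr 1
    rw [show (Finset.range ⌊y / logNorm p⌋₊).filter (· < (primeFactors s).count p) =
      Finset.range ((primeFactors s).count p) by ext k; simp; omega, Finset.card_range]
  rw [Finset.sum_congr rfl hinner]
  symm
  refine Finset.sum_subset hsub fun p _ hp => ?_
  rw [Multiset.mem_toFinset] at hp
  rw [Multiset.count_eq_zero.2 hp, zero_smul]

theorem sum_dvd_eq (h1 : nrm (1 : S) = 1) (y : ℝ) (d : S) (f : S → ℝ) :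
    ∑ s ∈ ball S y, (if d ∣ s then f s else 0) = ∑ m ∈ ball S (y - logNorm d), f (d * m) := by
  rw [← Finset.sum_filter]
  have : (ball S y).filter (d ∣ ·) = (ball S (y - logNorm d)).image (d * ·) := by
    ext s
    simp only [Finset.mem_filter, mem_ball, Finset.mem_image]
    constructor
    · rintro ⟨hs, m, rfl⟩
      rw [logNorm_mul h1] at hs
      exact ⟨m, by linarith, rfl⟩
    · rintro ⟨m, hm, rfl⟩
      rw [logNorm_mul h1]
      exact ⟨by linarith, dvd_mul_right d m⟩
  rw [this, Finset.sum_image fun a _ b _ h => mul_left_injective' d h]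

theorem sum_logNorm_mul (h1 : nrm (1 : S) = 1) (y : ℝ) (f : S → ℝ) :
    ∑ s ∈ ball S y, logNorm s * f s =
      ∑ d ∈ ball S y, vonMangoldt d * ∑ m ∈ ball S (y - logNorm d), f (d * m) := by
  rw [Finset.sum_congr rfl fun s hs => by rw [← sum_vonMangoldt_dvd h1 hs, Finset.sum_mul],
    Finset.sum_comm]
  refine Finset.sum_congr rfl fun d _ => ?_
  rw [← sum_dvd_eq h1, Finset.mul_sum]
  refine Finset.sum_congr rfl fun s _ => ?_
  split_ifs <;> simp

theorem sum_ball_comm (h1 : nrm (1 : S) = 1) (y : ℝ) (F : S → S → ℝ) :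
    ∑ d ∈ ball S y, ∑ m ∈ ball S (y - logNorm d), F d m =
      ∑ m ∈ ball S y, ∑ d ∈ ball S (y - logNorm m), F d m := by
  refine Finset.sum_comm' fun d m => ?_
  have := logNorm_nonneg h1 d
  have := logNorm_nonneg h1 m
  simp only [mem_ball]
  constructor <;> rintro ⟨h, h'⟩ <;> constructor <;> linarith

theorem tendsto_of_abs_sub_le {f : ℝ → ℝ} {c : ℝ}
    (h : ∀ η > 0, ∃ C, ∀ᶠ y in atTop, |f y - c| ≤ η + C / y) : Tendsto f atTop (𝓝 c) := by
  rw [Metric.tendsto_nhds]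
  intro ε hε
  obtain ⟨C, hC⟩ := h (ε / 2) (half_pos hε)
  have h0 : Tendsto (fun y : ℝ => C / y) atTop (𝓝 0) := tendsto_const_nhds.div_atTop tendsto_id
  filter_upwards [hC, h0.eventually (gt_mem_nhds (half_pos hε))] with y hy hy'
  rw [Real.dist_eq]
  linarith

theorem tendsto_of_abs_sub_le_mul {f : ℝ → ℝ} {c : ℝ}
    (h : ∀ η > 0, ∃ C, 0 ≤ C ∧ ∀ᶠ y in atTop, |f y - c| ≤ η + C / y * |f y|) :
    Tendsto f atTop (𝓝 c) := by
  refine tendsto_of_abs_sub_le fun η hη => ?_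
  obtain ⟨C, hC0, hC⟩ := h η hη
  refine ⟨C * (2 * (|c| + η)), ?_⟩
  filter_upwards [hC, eventually_ge_atTop (2 * C + 1)] with y hy hyC
  have hy0 : 0 < y := by linarith
  have h1 : C / y ≤ 1 / 2 := by rw [div_le_iff₀ hy0]; linarith
  have h2 : |f y| ≤ |f y - c| + |c| := by simpa using abs_add_le (f y - c) c
  have h3 : C / y * |f y| ≤ 1 / 2 * |f y| := by gcongr
  have h4 : |f y| ≤ 2 * (|c| + η) := by linarith
  calc |f y - c| ≤ η + C / y * |f y| := hy
    _ ≤ η + C / y * (2 * (|c| + η)) := by gcongr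
    _ = _ := by ring

theorem exists_abs_sub_le {f w : ℝ → ℝ} {c : ℝ} (hf : MonotoneOn f (Set.Ici 0))
    (hf0 : ∀ t, 0 ≤ t → 0 ≤ f t) (hw : MonotoneOn w (Set.Ici 0)) (hw0 : ∀ t, 0 ≤ t → 0 ≤ w t)
    (hwpos : ∀ᶠ t in atTop, 0 < w t) (h : Tendsto (fun t => f t / w t) atTop (𝓝 c))
    {η : ℝ} (hη : 0 < η) : ∃ C, 0 ≤ C ∧ ∀ t, 0 ≤ t → |f t - c * w t| ≤ η * w t + C := by
  rw [Metric.tendsto_nhds] at h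
  obtain ⟨T, hT⟩ := eventually_atTop.1 ((h η hη).and hwpos)
  have hT0 : (0 : ℝ) ≤ max T 0 := le_max_right _ _
  refine ⟨f (max T 0) + |c| * w (max T 0),
    add_nonneg (hf0 _ hT0) (mul_nonneg (abs_nonneg c) (hw0 _ hT0)), fun t ht => ?_⟩
  rcases le_total (max T 0) t with h' | h'
  · obtain ⟨h1, h2⟩ := hT t ((le_max_left _ _).trans h')
    rw [Real.dist_eq] at h1
    have : f t - c * w t = (f t / w t - c) * w t := by field_simp
    rw [this, abs_mul, abs_of_pos h2]
    have := mul_le_mul_of_nonneg_right h1.le h2.le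
    have := hf0 _ hT0
    have := mul_nonneg (abs_nonneg c) (hw0 _ hT0)
    linarith
  · have h1 := hf ht hT0 h'
    have h2 := hw ht hT0 h'
    calc |f t - c * w t| ≤ |f t| + |c * w t| := abs_sub _ _
      _ = f t + |c| * w t := by
        rw [abs_of_nonneg (hf0 t ht), abs_mul, abs_of_nonneg (hw0 t ht)]
      _ ≤ f (max T 0) + |c| * w (max T 0) := by gcongr
      _ ≤ _ := le_add_of_nonneg_left (mul_nonneg hη.le (hw0 t ht))

/-- The summatory function of a weight on the semigroup, in logarithmic scale. -/
def summatory (w : S → ℝ) (y : ℝ) : ℝ := ∑ s ∈ ball S y, w s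

theorem summatory_mono {w : S → ℝ} (hw : ∀ s, 0 ≤ w s) : Monotone (summatory w) := fun _ _ h =>
  Finset.sum_le_sum_of_subset_of_nonneg (ball_mono h) fun s _ _ => hw s

theorem summatory_nonneg {w : S → ℝ} (hw : ∀ s, 0 ≤ w s) (y : ℝ) : 0 ≤ summatory w y :=
  Finset.sum_nonneg fun s _ => hw s

theorem summatory_eq_sum_ite (w : S → ℝ) {t y : ℝ} (h : t ≤ y) :
    summatory w t = ∑ s ∈ ball S y, if logNorm s ≤ t then w s else 0 := by
  rw [← Finset.sum_filter, summatory]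
  congr 1
  ext s
  simp only [mem_ball, Finset.mem_filter]
  exact ⟨fun h' => ⟨h'.trans h, h'⟩, fun h' => h'.2⟩

theorem hasIntegral_step {F F' : ℝ → ℝ} (hF : ∀ t, HasDerivAt F (F' t) t) (hF' : Continuous F')
    {a y : ℝ} (c : ℝ) (ha : 0 ≤ a) (hay : a ≤ y) :
    IntervalIntegrable (fun t => (if a ≤ t then c else 0) * F' t) volume 0 y ∧
      ∫ t in (0 : ℝ)..y, (if a ≤ t then c else 0) * F' t = c * (F y - F a) := by
  have h1 : Set.EqOn (fun _ : ℝ => (0 : ℝ)) (fun t => (if a ≤ t then c else 0) * F' t)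
      (Set.uIoo 0 a) := fun t ht => by
    rw [Set.uIoo_of_le ha] at ht
    simp [not_le.2 ht.2]
  have h2 : Set.EqOn (fun t : ℝ => c * F' t) (fun t => (if a ≤ t then c else 0) * F' t)
      (Set.uIoo a y) := fun t ht => by
    rw [Set.uIoo_of_le hay] at ht
    simp [ht.1.le]
  have i1 : IntervalIntegrable (fun t => (if a ≤ t then c else 0) * F' t) volume 0 a :=
    intervalIntegrable_const.congr_uIoo h1
  have i2 : IntervalIntegrable (fun t => (if a ≤ t then c else 0) * F' t) volume a y :=
    ((hF'.intervalIntegrable a y).const_mul c).congr_uIoo h2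
  refine ⟨i1.trans i2, ?_⟩
  rw [← intervalIntegral.integral_add_adjacent_intervals i1 i2,
    ← intervalIntegral.integral_congr_uIoo h1, ← intervalIntegral.integral_congr_uIoo h2,
    intervalIntegral.integral_const_mul,
    intervalIntegral.integral_eq_sub_of_hasDerivAt (fun t _ => hF t) (hF'.intervalIntegrable a y)]
  simp

theorem intervalIntegrable_summatory_mul (h1 : nrm (1 : S) = 1) (w : S → ℝ) {F F' : ℝ → ℝ}
    (hF : ∀ t, HasDerivAt F (F' t) t) (hF' : Continuous F') {y : ℝ} (hy : 0 ≤ y) :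
    IntervalIntegrable (fun t => summatory w t * F' t) volume 0 y ∧
    ∫ t in (0 : ℝ)..y, summatory w t * F' t = ∑ s ∈ ball S y, w s * (F y - F (logNorm s)) := by
  have h : Set.EqOn
      (fun t => ∑ s ∈ ball S y, (if logNorm s ≤ t then w s else 0) * F' t)
      (fun t => summatory w t * F' t) (Set.uIoo 0 y) := fun t ht => by
    rw [Set.uIoo_of_le hy] at ht
    simp only [summatory_eq_sum_ite w ht.2.le, Finset.sum_mul]
  have hs := fun s (hs : s ∈ ball S y) =>
    hasIntegral_step hF hF' (w s) (logNorm_nonneg h1 s) (mem_ball.1 hs)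
  have hi : IntervalIntegrable
      (fun t => ∑ s ∈ ball S y, (if logNorm s ≤ t then w s else 0) * F' t) volume 0 y := by
    have := IntervalIntegrable.sum (ball S y) fun s h => (hs s h).1
    rwa [show (∑ s ∈ ball S y, fun t => (if logNorm s ≤ t then w s else 0) * F' t) =
      fun t => ∑ s ∈ ball S y, (if logNorm s ≤ t then w s else 0) * F' t by
        ext t; simp only [Finset.sum_apply]] at this
  refine ⟨hi.congr_uIoo h, ?_⟩
  rw [← intervalIntegral.integral_congr_uIoo h,
    intervalIntegral.integral_finsetSum fun s h => (hs s h).1]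
  exact Finset.sum_congr rfl fun s h => (hs s h).2

theorem tendsto_summatory_mul_exp_neg (h1 : nrm (1 : S) = 1) {w : S → ℝ} (hw : ∀ s, 0 ≤ w s)
    {c : ℝ} (h : Tendsto (fun y => summatory w y * Real.exp (-y)) atTop (𝓝 c)) :
    Tendsto (fun y => summatory (fun s => w s * Real.exp (-logNorm s)) y / y) atTop (𝓝 c) := by
  refine tendsto_of_abs_sub_le fun η hη => ?_
  have h' : Tendsto (fun y => summatory w y / Real.exp y) atTop (𝓝 c) := by
    simpa [Real.exp_neg, div_eq_mul_inv] using h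
  obtain ⟨C, hC0, hC⟩ := exists_abs_sub_le ((summatory_mono hw).monotoneOn _)
    (fun t _ => summatory_nonneg hw t) (Real.exp_monotone.monotoneOn _)
    (fun t _ => (Real.exp_pos t).le) (Eventually.of_forall Real.exp_pos) h' hη
  have hC' : ∀ t, 0 ≤ t → |summatory w t * Real.exp (-t) - c| ≤ η + C * Real.exp (-t) := by
    intro t ht
    have : summatory w t * Real.exp (-t) - c
        = (summatory w t - c * Real.exp t) * Real.exp (-t) := by
      rw [sub_mul, mul_assoc c, ← Real.exp_add]; simp
    rw [this, abs_mul, abs_of_pos (Real.exp_pos _)]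
    calc _ ≤ (η * Real.exp t + C) * Real.exp (-t) := by gcongr; exact hC t ht
      _ = _ := by rw [add_mul, mul_assoc η, ← Real.exp_add]; simp
  refine ⟨2 * C + |c| + η, ?_⟩
  filter_upwards [eventually_gt_atTop 0] with y hy
  have hd : ∀ t : ℝ, HasDerivAt (fun t => -Real.exp (-t)) (Real.exp (-t)) t := fun t =>
    HasDerivAt.congr_deriv (f := fun t => -Real.exp (-t)) (hasDerivAt_neg t).exp.neg (by simp)
  obtain ⟨i1, i2⟩ := intervalIntegrable_summatory_mul h1 w hd (by fun_prop) hy.le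
  have e1 : summatory (fun s => w s * Real.exp (-logNorm s)) y =
      summatory w y * Real.exp (-y) + ∫ t in (0 : ℝ)..y, summatory w t * Real.exp (-t) := by
    rw [i2, summatory, summatory, Finset.sum_mul, ← Finset.sum_add_distrib]
    exact Finset.sum_congr rfl fun s _ => by ring
  have hexp : IntervalIntegrable (fun t => Real.exp (-t)) volume 0 y :=
    (by fun_prop : Continuous fun t : ℝ => Real.exp (-t)).intervalIntegrable _ _
  have e2 : |(∫ t in (0 : ℝ)..y, summatory w t * Real.exp (-t)) - c * y| ≤ η * y + C := by
    have e3 : (∫ t in (0 : ℝ)..y, summatory w t * Real.exp (-t)) - c * y =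
        ∫ t in (0 : ℝ)..y, (summatory w t * Real.exp (-t) - c) := by
      rw [intervalIntegral.integral_sub i1 intervalIntegrable_const]
      simp [mul_comm]
    rw [e3]
    calc _ ≤ ∫ t in (0 : ℝ)..y, |summatory w t * Real.exp (-t) - c| :=
          intervalIntegral.abs_integral_le_integral_abs hy.le
      _ ≤ ∫ t in (0 : ℝ)..y, (η + C * Real.exp (-t)) :=
          intervalIntegral.integral_mono_on hy.le (i1.sub intervalIntegrable_const).abs
            (intervalIntegrable_const.add (hexp.const_mul C)) fun t ht => hC' t ht.1
      _ = η * y + C * (1 - Real.exp (-y)) := by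
          rw [intervalIntegral.integral_add intervalIntegrable_const (hexp.const_mul C),
            intervalIntegral.integral_const_mul,
            intervalIntegral.integral_eq_sub_of_hasDerivAt (fun t _ => hd t) hexp]
          rw [intervalIntegral.integral_const, neg_zero, Real.exp_zero, smul_eq_mul]
          ring
      _ ≤ η * y + C := by
          have := mul_nonneg hC0 (Real.exp_pos (-y)).le
          linarith
  have e4 : |summatory w y * Real.exp (-y)| ≤ |c| + η + C := by
    have h2 := hC' y hy.le
    have h3 : Real.exp (-y) ≤ 1 := Real.exp_le_one_iff.2 (by linarith)
    have h4 := mul_le_mul_of_nonneg_left h3 hC0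
    have h5 := abs_add_le (summatory w y * Real.exp (-y) - c) c
    rw [sub_add_cancel] at h5
    linarith
  have e5 : summatory (fun s => w s * Real.exp (-logNorm s)) y / y - c =
      (summatory w y * Real.exp (-y) +
        ((∫ t in (0 : ℝ)..y, summatory w t * Real.exp (-t)) - c * y)) / y := by
    rw [e1]; field_simp; ring
  rw [e5, abs_div, abs_of_pos hy, div_le_iff₀ hy]
  have e6 : (η + (2 * C + |c| + η) / y) * y = η * y + (2 * C + |c| + η) := by field_simp
  rw [e6]
  exact (abs_add_le _ _).trans (by linarith)

/-- `∑_{|s| ≤ e^y} Λ(s) / |s|`. -/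
def mertensSum (S : Type*) [NormedArithmeticSemigroup S] (y : ℝ) : ℝ :=
  summatory (fun d : S => vonMangoldt d * Real.exp (-logNorm d)) y

/-- `∑_{|p| ≤ e^y} log |p| / |p|`. -/
def primeMertensSum (S : Type*) [NormedArithmeticSemigroup S] (y : ℝ) : ℝ :=
  ∑ p ∈ primeBall S y, logNorm p * Real.exp (-logNorm p)

/-- `∑_{|s| ≤ e^y} 1 / |s|`. -/
def harmonicSum (S : Type*) [NormedArithmeticSemigroup S] (y : ℝ) : ℝ :=
  summatory (fun s : S => Real.exp (-logNorm s)) y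

/-- `∑_{|s| ≤ e^y} (y - log |s|) / |s|`. -/
def harmonicIntegral (S : Type*) [NormedArithmeticSemigroup S] (y : ℝ) : ℝ :=
  ∑ s ∈ ball S y, Real.exp (-logNorm s) * (y - logNorm s)

/-- The consequences of either growth hypothesis that determine the limit law. -/
structure RegularGrowth (S : Type*) [NormedArithmeticSemigroup S] (θ : ℝ) : Prop where
  nrm_one : nrm (1 : S) = 1
  primes : Tendsto (fun y => primeMertensSum S y / y) atTop (𝓝 θ)
  count : Tendsto (fun y => y * (ball S y).card / (Real.exp y * harmonicSum S y)) atTop (𝓝 θ)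
  harmonic : ∀ r : ℝ, 0 < r → r < 1 →
    Tendsto (fun y => harmonicSum S (r * y) / harmonicSum S y) atTop (𝓝 (r ^ θ))

theorem harmonicSum_mono : Monotone (harmonicSum S) :=
  summatory_mono fun _ => (Real.exp_pos _).le

theorem one_le_harmonicSum (h1 : nrm (1 : S) = 1) {y : ℝ} (hy : 0 ≤ y) : 1 ≤ harmonicSum S y := by
  have : Real.exp (-logNorm (1 : S)) ≤ harmonicSum S y :=
    Finset.single_le_sum (f := fun s : S => Real.exp (-logNorm s))
      (fun s _ => (Real.exp_pos _).le) (mem_ball.2 (by rwa [logNorm_one h1]))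
  simpa [logNorm_one h1] using this

theorem le_harmonicIntegral (h1 : nrm (1 : S) = 1) {y : ℝ} (hy : 0 ≤ y) :
    y ≤ harmonicIntegral S y := by
  have : Real.exp (-logNorm (1 : S)) * (y - logNorm (1 : S)) ≤ harmonicIntegral S y :=
    Finset.single_le_sum (f := fun s : S => Real.exp (-logNorm s) * (y - logNorm s))
      (fun s hs => mul_nonneg (Real.exp_pos _).le (sub_nonneg.2 (mem_ball.1 hs)))
      (mem_ball.2 (by rwa [logNorm_one h1]))
  simpa [logNorm_one h1] using this

theorem mertensSum_mono : Monotone (mertensSum S) :=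
  summatory_mono fun _ => mul_nonneg (vonMangoldt_nonneg _) (Real.exp_pos _).le

theorem mertensSum_nonneg (y : ℝ) : 0 ≤ mertensSum S y :=
  summatory_nonneg (fun _ => mul_nonneg (vonMangoldt_nonneg _) (Real.exp_pos _).le) y

theorem sum_logNorm_mul_exp_neg (h1 : nrm (1 : S) = 1) (y : ℝ) :
    y * harmonicSum S y - harmonicIntegral S y =
      ∑ d ∈ ball S y, vonMangoldt d * Real.exp (-logNorm d) * harmonicSum S (y - logNorm d) := by
  have := sum_logNorm_mul h1 y fun s => Real.exp (-logNorm s)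
  simp only [logNorm_mul h1, neg_add, Real.exp_add, ← Finset.mul_sum, ← mul_assoc] at this
  unfold harmonicSum summatory at *
  rw [← this, harmonicIntegral, Finset.mul_sum, ← Finset.sum_sub_distrib]
  exact Finset.sum_congr rfl fun s _ => by ring

theorem sum_mertensSum (h1 : nrm (1 : S) = 1) (y : ℝ) :
    y * harmonicSum S y - harmonicIntegral S y =
      ∑ s ∈ ball S y, Real.exp (-logNorm s) * mertensSum S (y - logNorm s) := by
  have := sum_ball_comm h1 y
    fun d m => vonMangoldt d * Real.exp (-logNorm d) * Real.exp (-logNorm m)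
  rw [sum_logNorm_mul_exp_neg h1]
  simp only [harmonicSum, mertensSum, summatory, Finset.mul_sum]
  rw [this]
  exact Finset.sum_congr rfl fun s _ => Finset.sum_congr rfl fun d _ => by ring

theorem tendsto_primeMertensSum (h1 : nrm (1 : S) = 1) {c : ℝ}
    (h : Tendsto (fun y => mertensSum S y / y) atTop (𝓝 c)) :
    Tendsto (fun y => primeMertensSum S y / y) atTop (𝓝 c) := by
  have hc0 : 0 ≤ c := ge_of_tendsto h (by
    filter_upwards [eventually_ge_atTop 0] with y hy using div_nonneg (mertensSum_nonneg y) hy)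
  refine tendsto_of_abs_sub_le fun η hη => ?_
  obtain ⟨ε, hε, hεη⟩ : ∃ ε > 0, ε + ε * (c + ε) ≤ η := by
    refine ⟨min 1 (η / (c + 2)), by positivity, ?_⟩
    have h2 : min 1 (η / (c + 2)) ≤ 1 := min_le_left _ _
    have h3 : min 1 (η / (c + 2)) * (c + 2) ≤ η :=
      (le_div_iff₀ (by positivity)).1 (min_le_right _ _)
    have h4 : 0 < min 1 (η / (c + 2)) := by positivity
    nlinarith
  obtain ⟨L, hL0, hL⟩ : ∃ L > 0, Real.exp (-L) ≤ ε * (1 - Real.exp (-L)) := by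
    have h0 := Real.tendsto_exp_neg_atTop_nhds_zero
    have h2 : Tendsto (fun L => ε * (1 - Real.exp (-L))) atTop (𝓝 (ε * (1 - 0))) :=
      (h0.const_sub 1).const_mul ε
    obtain ⟨L, hL, hL'⟩ := ((h0.eventually_lt h2 (by simpa using hε)).and
      (eventually_gt_atTop 0)).exists
    exact ⟨L, hL', hL.le⟩
  let g : S → ℝ := fun p =>
    logNorm p * (Real.exp (-logNorm p) ^ 2 / (1 - Real.exp (-logNorm p)))
  have hx : ∀ p : S, Irreducible p → Real.exp (-logNorm p) < 1 := fun p hp =>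
    Real.exp_lt_one_iff.2 (by linarith [logNorm_prime_pos hp])
  have hg0 : ∀ p : S, Irreducible p → 0 ≤ g p := fun p hp =>
    mul_nonneg (logNorm_prime_pos hp).le
      (div_nonneg (sq_nonneg _) (sub_nonneg.2 (hx p hp).le))
  have hterm : ∀ p : S, Irreducible p → ∀ K : ℕ,
      ∑ k ∈ Finset.range K, logNorm p * Real.exp (-logNorm (p ^ (k + 1))) ≤
        logNorm p * Real.exp (-logNorm p) + g p := by
    intro p hp K
    have hx1 := hx p hp
    have hx0 := Real.exp_pos (-logNorm p)
    set x := Real.exp (-logNorm p) with hxdef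
    have hpow : ∀ k : ℕ, Real.exp (-logNorm (p ^ (k + 1))) = x * x ^ k := fun k => by
      rw [logNorm_pow h1, ← pow_succ', hxdef, ← Real.exp_nat_mul]; congr 1; ring
    simp only [hpow]
    rw [← Finset.mul_sum, ← Finset.mul_sum]
    have hgeo : ∑ k ∈ Finset.range K, x ^ k ≤ 1 / (1 - x) := by
      have := geom_sum_mul_neg x K
      rw [le_div_iff₀ (by linarith), this]
      linarith [pow_pos hx0 K]
    calc logNorm p * (x * ∑ k ∈ Finset.range K, x ^ k)
        ≤ logNorm p * (x * (1 / (1 - x))) := by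
          have := (logNorm_prime_pos hp).le
          gcongr
      _ = logNorm p * x + logNorm p * (x ^ 2 / (1 - x)) := by
          have : 1 - x ≠ 0 := by linarith
          field_simp
          ring
  have hlow : ∀ y, primeMertensSum S y ≤ mertensSum S y := by
    intro y
    unfold mertensSum summatory
    have : primeMertensSum S y =
        ∑ p ∈ primeBall S y, vonMangoldt p * Real.exp (-logNorm p) :=
      Finset.sum_congr rfl fun p hp => by
        have := vonMangoldt_pow (mem_primeBall.1 hp).2 0
        rw [zero_add, pow_one] at this
        rw [this]
    rw [this]
    exact Finset.sum_le_sum_of_subset_of_nonneg (Finset.filter_subset _ _)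
      fun d _ _ => mul_nonneg (vonMangoldt_nonneg _) (Real.exp_pos _).le
  have hup : ∀ y, mertensSum S y ≤
      primeMertensSum S y + (∑ p ∈ primeBall S L, g p + ε * primeMertensSum S y) := by
    intro y
    unfold mertensSum summatory
    rw [sum_vonMangoldt_mul h1]
    refine (Finset.sum_le_sum fun p hp => hterm p (mem_primeBall.1 hp).2 _).trans ?_
    rw [Finset.sum_add_distrib]
    refine add_le_add le_rfl ?_
    rw [← Finset.sum_filter_add_sum_filter_not (primeBall S y) (fun p => logNorm p ≤ L),
      primeMertensSum, Finset.mul_sum]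
    refine add_le_add ?_ ?_
    · refine Finset.sum_le_sum_of_subset_of_nonneg (fun p hp => ?_)
        fun p hp _ => hg0 p (mem_primeBall.1 hp).2
      simp only [Finset.mem_filter, mem_primeBall] at hp ⊢
      exact ⟨hp.2, hp.1.2⟩
    · refine (Finset.sum_le_sum fun p hp => ?_).trans
        (Finset.sum_le_sum_of_subset_of_nonneg (Finset.filter_subset _ _)
          fun p hp _ => mul_nonneg hε.le (mul_nonneg (logNorm_nonneg h1 p) (Real.exp_pos _).le))
      simp only [Finset.mem_filter, mem_primeBall, not_le] at hp
      have hx1 := hx p hp.1.2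
      have hx0 := Real.exp_pos (-logNorm p)
      have hxL : Real.exp (-logNorm p) ≤ Real.exp (-L) := Real.exp_le_exp.2 (by linarith)
      have hl := logNorm_nonneg h1 p
      have : Real.exp (-logNorm p) ^ 2 / (1 - Real.exp (-logNorm p)) ≤
          ε * Real.exp (-logNorm p) := by
        rw [div_le_iff₀ (by linarith), sq, mul_right_comm]
        refine mul_le_mul_of_nonneg_right (hxL.trans (hL.trans ?_)) hx0.le
        gcongr
      calc g p ≤ logNorm p * (ε * Real.exp (-logNorm p)) := mul_le_mul_of_nonneg_left this hl
        _ = _ := by ring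
  refine ⟨∑ p ∈ primeBall S L, g p, ?_⟩
  rw [Metric.tendsto_nhds] at h
  filter_upwards [h ε hε, eventually_gt_atTop 0] with y hy hy0
  rw [Real.dist_eq, abs_lt] at hy
  have e1 : primeMertensSum S y / y ≤ mertensSum S y / y := by gcongr; exact hlow y
  have e2 : mertensSum S y / y ≤ primeMertensSum S y / y +
      (∑ p ∈ primeBall S L, g p) / y + ε * (primeMertensSum S y / y) := by
    calc _ ≤ (primeMertensSum S y +
          (∑ p ∈ primeBall S L, g p + ε * primeMertensSum S y)) / y := by gcongr; exact hup y
      _ = _ := by ring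
  have e3 : 0 ≤ (∑ p ∈ primeBall S L, g p) / y :=
    div_nonneg (Finset.sum_nonneg fun p hp => hg0 p (mem_primeBall.1 hp).2) hy0.le
  have e4 : ε * (primeMertensSum S y / y) ≤ ε * (c + ε) := by gcongr; linarith
  have e5 : 0 ≤ ε * (c + ε) := by positivity
  rw [abs_le]
  constructor <;> linarith

theorem exists_abs_sub_mul_id_le {f : ℝ → ℝ} {c : ℝ} (hf : Monotone f) (hf0 : ∀ t, 0 ≤ f t)
    (h : Tendsto (fun t => f t / t) atTop (𝓝 c)) {η : ℝ} (hη : 0 < η) :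
    ∃ C, 0 ≤ C ∧ ∀ t, 0 ≤ t → |f t - c * t| ≤ η * t + C :=
  exists_abs_sub_le (w := fun t => t) (hf.monotoneOn _) (fun t _ => hf0 t)
    (monotone_id.monotoneOn _) (fun _ ht => ht) (eventually_gt_atTop 0) h hη

theorem harmonicIntegral_eq_sum {y z : ℝ} (h : y ≤ z) :
    harmonicIntegral S y = ∑ s ∈ ball S z, Real.exp (-logNorm s) * max (y - logNorm s) 0 := by
  rw [harmonicIntegral]
  refine Finset.sum_subset_zero_on_sdiff (ball_mono h) (fun s hs => ?_) fun s hs => ?_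
  · simp only [Finset.mem_sdiff, mem_ball, not_le] at hs
    rw [max_eq_right (by linarith), mul_zero]
  · rw [max_eq_left (sub_nonneg.2 (mem_ball.1 hs))]

theorem hasDerivWithinAt_harmonicIntegral (y : ℝ) :
    HasDerivWithinAt (harmonicIntegral S) (harmonicSum S y) (Set.Ici y) y := by
  have hmax : ∀ s : S, HasDerivWithinAt (fun z => max (z - logNorm s) 0)
      (if logNorm s ≤ y then 1 else 0) (Set.Ici y) y := by
    intro s
    split_ifs with h
    · refine ((hasDerivWithinAt_id y _).sub_const (logNorm s)).congr (fun z hz => ?_) ?_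
      · exact max_eq_left (by have := Set.mem_Ici.1 hz; linarith)
      · exact max_eq_left (by linarith)
    · refine HasDerivAt.hasDerivWithinAt ?_
      refine (hasDerivAt_const y (0 : ℝ)).congr_of_eventuallyEq ?_
      filter_upwards [gt_mem_nhds (not_le.1 h)] with z hz
      exact max_eq_right (by linarith)
  have hsum : HasDerivWithinAt
      (fun z => ∑ s ∈ ball S (y + 1), Real.exp (-logNorm s) * max (z - logNorm s) 0)
      (∑ s ∈ ball S (y + 1), Real.exp (-logNorm s) * (if logNorm s ≤ y then 1 else 0))
      (Set.Ici y) y :=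
    HasDerivWithinAt.fun_sum fun s _ => (hmax s).const_mul _
  have hval : harmonicSum S y =
      ∑ s ∈ ball S (y + 1), Real.exp (-logNorm s) * (if logNorm s ≤ y then 1 else 0) := by
    rw [harmonicSum, summatory_eq_sum_ite _ (by linarith : y ≤ y + 1)]
    exact Finset.sum_congr rfl fun s _ => by split_ifs <;> simp
  rw [hval]
  refine hsum.congr_of_eventuallyEq ?_ (harmonicIntegral_eq_sum (by linarith))
  filter_upwards [mem_nhdsWithin_of_mem_nhds (Iio_mem_nhds (by linarith : y < y + 1))] with z hz
  exact harmonicIntegral_eq_sum (Set.mem_Iio.1 hz).le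

theorem continuousOn_harmonicIntegral (a b : ℝ) :
    ContinuousOn (harmonicIntegral S) (Set.Icc a b) := by
  have : Continuous fun y : ℝ =>
      ∑ s ∈ ball S b, Real.exp (-logNorm s) * max (y - logNorm s) 0 := by fun_prop
  exact this.continuousOn.congr fun y hy => harmonicIntegral_eq_sum hy.2

theorem tendsto_mul_harmonicSum_div (h1 : nrm (1 : S) = 1) {θ : ℝ}
    (hM : Tendsto (fun y => mertensSum S y / y) atTop (𝓝 θ)) :
    Tendsto (fun y => y * harmonicSum S y / harmonicIntegral S y) atTop (𝓝 (1 + θ)) := by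
  refine tendsto_of_abs_sub_le_mul fun η hη => ?_
  obtain ⟨C, hC0, hC⟩ := exists_abs_sub_mul_id_le mertensSum_mono mertensSum_nonneg hM hη
  refine ⟨C, hC0, ?_⟩
  filter_upwards [eventually_gt_atTop 0] with y hy
  have hI : 0 < harmonicIntegral S y := hy.trans_le (le_harmonicIntegral h1 hy.le)
  have hm : 0 < harmonicSum S y := one_pos.trans_le (one_le_harmonicSum h1 hy.le)
  have key : |y * harmonicSum S y - (1 + θ) * harmonicIntegral S y| ≤
      η * harmonicIntegral S y + C * harmonicSum S y := by
    have e : y * harmonicSum S y - (1 + θ) * harmonicIntegral S y = ∑ s ∈ ball S y,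
        Real.exp (-logNorm s) * (mertensSum S (y - logNorm s) - θ * (y - logNorm s)) := by
      have h2 : θ * harmonicIntegral S y =
          ∑ s ∈ ball S y, Real.exp (-logNorm s) * (θ * (y - logNorm s)) := by
        rw [harmonicIntegral, Finset.mul_sum]
        exact Finset.sum_congr rfl fun s _ => by ring
      rw [add_mul, one_mul, ← sub_sub, sum_mertensSum h1 y, h2, ← Finset.sum_sub_distrib]
      exact Finset.sum_congr rfl fun s _ => by ring
    rw [e]
    calc _ ≤ ∑ s ∈ ball S y, Real.exp (-logNorm s) * (η * (y - logNorm s) + C) := by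
          refine (Finset.abs_sum_le_sum_abs _ _).trans (Finset.sum_le_sum fun s hs => ?_)
          rw [abs_mul, abs_of_pos (Real.exp_pos _)]
          gcongr
          exact hC _ (sub_nonneg.2 (mem_ball.1 hs))
      _ = _ := by
          rw [harmonicIntegral, harmonicSum, summatory, Finset.mul_sum, Finset.mul_sum,
            ← Finset.sum_add_distrib]
          exact Finset.sum_congr rfl fun s _ => by ring
  rw [abs_of_pos (div_pos (mul_pos hy hm) hI),
    show y * harmonicSum S y / harmonicIntegral S y - (1 + θ) =
      (y * harmonicSum S y - (1 + θ) * harmonicIntegral S y) / harmonicIntegral S y by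
        field_simp, abs_div, abs_of_pos hI, div_le_iff₀ hI]
  refine key.trans (le_of_eq ?_)
  field_simp

theorem tendsto_harmonicIntegral_ratio (h1 : nrm (1 : S) = 1) {θ : ℝ}
    (hM : Tendsto (fun y => mertensSum S y / y) atTop (𝓝 θ)) {r : ℝ} (hr : 0 < r) (hr1 : r < 1) :
    Tendsto (fun y => harmonicIntegral S (r * y) / harmonicIntegral S y) atTop
      (𝓝 (r ^ (1 + θ))) := by
  have hq := tendsto_mul_harmonicSum_div h1 hM
  have hpos : ∀ y, 0 < y → 0 < harmonicIntegral S y := fun y hy =>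
    hy.trans_le (le_harmonicIntegral h1 hy.le)
  let φ : ℝ → ℝ := fun t => Real.log (harmonicIntegral S t) - (1 + θ) * Real.log t
  have hφ : Tendsto (fun y => φ y - φ (r * y)) atTop (𝓝 0) := by
    refine tendsto_of_abs_sub_le fun η hη => ⟨0, ?_⟩
    have hη' : 0 < η * r := by positivity
    rw [Metric.tendsto_nhds] at hq
    obtain ⟨T, hT⟩ := eventually_atTop.1 (hq _ hη')
    filter_upwards [eventually_ge_atTop (T / r), eventually_gt_atTop 0] with y hyT hy
    have hry : 0 < r * y := by positivity
    have hTy : T ≤ r * y := by rw [div_le_iff₀ hr] at hyT; linarith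
    have hle : r * y ≤ y := by nlinarith
    have := norm_image_sub_le_of_norm_deriv_right_le_segment (f := φ)
      (f' := fun t => harmonicSum S t / harmonicIntegral S t - (1 + θ) * t⁻¹)
      (C := η / y) (a := r * y) (b := y) ?_ ?_ ?_ y (Set.right_mem_Icc.2 hle)
    · rw [Real.norm_eq_abs] at this
      simp only [zero_div, add_zero, sub_zero]
      refine this.trans ?_
      rw [div_mul_eq_mul_div, div_le_iff₀ hy]
      nlinarith [mul_pos hη hry]
    · refine ContinuousOn.sub ?_ (ContinuousOn.mul continuousOn_const ?_)
      · exact (continuousOn_harmonicIntegral _ _).log fun t ht =>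
          (hpos t (hry.trans_le ht.1)).ne'
      · exact continuousOn_id.log fun t ht => (hry.trans_le ht.1).ne'
    · intro t ht
      have ht0 : 0 < t := hry.trans_le ht.1
      exact ((hasDerivWithinAt_harmonicIntegral t).log (hpos t ht0).ne').sub
        ((Real.hasDerivAt_log ht0.ne').hasDerivWithinAt.const_mul _)
    · intro t ht
      have ht0 : 0 < t := hry.trans_le ht.1
      have h2 := hT t (hTy.trans ht.1)
      rw [Real.dist_eq] at h2
      have e : harmonicSum S t / harmonicIntegral S t - (1 + θ) * t⁻¹ =
          (t * harmonicSum S t / harmonicIntegral S t - (1 + θ)) / t := by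
        have := (hpos t ht0).ne'
        field_simp
      rw [Real.norm_eq_abs, e, abs_div, abs_of_pos ht0, div_le_div_iff₀ ht0 hy]
      calc _ ≤ η * r * y := by gcongr
        _ = η * (r * y) := by ring
        _ ≤ η * t := by gcongr; exact ht.1
  have hexp := (Real.continuous_exp.tendsto _).comp (hφ.const_sub ((1 + θ) * Real.log r))
  rw [sub_zero, mul_comm, ← Real.rpow_def_of_pos hr] at hexp
  refine hexp.congr' ?_
  filter_upwards [eventually_gt_atTop 0] with y hy
  have hry : 0 < r * y := by positivity
  simp only [Function.comp, φ]
  rw [Real.log_mul hr.ne' hy.ne', show Real.log r * (1 + θ) -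
    (Real.log (harmonicIntegral S y) - (1 + θ) * Real.log y -
      (Real.log (harmonicIntegral S (r * y)) - (1 + θ) * (Real.log r + Real.log y))) =
    Real.log (harmonicIntegral S (r * y)) - Real.log (harmonicIntegral S y) by ring,
    Real.exp_sub, Real.exp_log (hpos _ hry), Real.exp_log (hpos _ hy)]

theorem tendsto_harmonicSum_ratio (h1 : nrm (1 : S) = 1) {θ : ℝ} (hθ : 0 < θ)
    (hM : Tendsto (fun y => mertensSum S y / y) atTop (𝓝 θ)) {r : ℝ} (hr : 0 < r) (hr1 : r < 1) :
    Tendsto (fun y => harmonicSum S (r * y) / harmonicSum S y) atTop (𝓝 (r ^ θ)) := by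
  have hq := tendsto_mul_harmonicSum_div h1 hM
  have hqr := hq.comp (tendsto_id.const_mul_atTop hr)
  have hI := tendsto_harmonicIntegral_ratio h1 hM hr hr1
  have h := ((hqr.div hq (by linarith)).mul hI).div_const r
  have e : (1 + θ) / (1 + θ) * r ^ (1 + θ) / r = r ^ θ := by
    rw [div_self (by linarith), Real.rpow_add hr, Real.rpow_one]
    field_simp
  rw [e] at h
  refine h.congr' ?_
  filter_upwards [eventually_gt_atTop 0] with y hy
  have hry : 0 < r * y := by positivity
  have a1 := (hy.trans_le (le_harmonicIntegral h1 hy.le)).ne'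
  have a2 := (hry.trans_le (le_harmonicIntegral h1 hry.le)).ne'
  have a3 := (one_pos.trans_le (one_le_harmonicSum h1 hy.le)).ne'
  simp only [Function.comp, id, Pi.div_apply]
  field_simp

/-- The Chebyshev function `∑_{|d| ≤ e^y} Λ(d)`. -/
def chebyshevSum (S : Type*) [NormedArithmeticSemigroup S] (y : ℝ) : ℝ :=
  summatory (vonMangoldt : S → ℝ) y

theorem tendsto_chebyshevSum (h1 : nrm (1 : S) = 1) {θ : ℝ}
    (h : Tendsto (fun y => y * (primeBall S y).card * Real.exp (-y)) atTop (𝓝 θ)) :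
    Tendsto (fun y => chebyshevSum S y * Real.exp (-y)) atTop (𝓝 θ) := by
  have hup : ∀ y, 0 < y → chebyshevSum S y ≤ y * (primeBall S y).card := by
    intro y hy
    have := sum_vonMangoldt_mul h1 y (fun _ : S => 1)
    simp only [mul_one] at this
    rw [chebyshevSum, summatory, this, mul_comm, ← nsmul_eq_mul]
    refine Finset.sum_le_card_nsmul _ _ _ fun p hp => ?_
    have hp0 := logNorm_prime_pos (mem_primeBall.1 hp).2
    rw [Finset.sum_const, Finset.card_range, nsmul_eq_mul, ← le_div_iff₀ hp0]
    exact Nat.floor_le (div_nonneg hy.le hp0.le)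
  have hlow : ∀ r, 0 < r → r < 1 → ∀ y, 0 < y →
      r * y * ((primeBall S y).card - (primeBall S (r * y)).card) ≤ chebyshevSum S y := by
    intro r hr hr1 y hy
    have hsub : primeBall S (r * y) ⊆ primeBall S y := primeBall_mono (by nlinarith)
    rw [← Nat.cast_sub (Finset.card_le_card hsub), ← Finset.card_sdiff_of_subset hsub, mul_comm,
      ← nsmul_eq_mul]
    refine (Finset.card_nsmul_le_sum _ (vonMangoldt : S → ℝ) _ fun p hp => ?_).trans
      (Finset.sum_le_sum_of_subset_of_nonneg
        (Finset.sdiff_subset.trans (Finset.filter_subset _ _)) fun d _ _ => vonMangoldt_nonneg d)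
    simp only [Finset.mem_sdiff, mem_primeBall, not_and] at hp
    have hv := vonMangoldt_pow hp.1.2 0
    rw [zero_add, pow_one] at hv
    rw [hv]
    by_contra! hlt
    exact hp.2 hlt.le hp.1.2
  have hθ0 : 0 ≤ θ := ge_of_tendsto h (by
    filter_upwards [eventually_ge_atTop 0] with y hy using by positivity)
  have hlim : ∀ r, 0 < r → r < 1 → Tendsto (fun y => r * y *
      ((primeBall S y).card - (primeBall S (r * y)).card) * Real.exp (-y)) atTop (𝓝 (r * θ)) := by
    intro r hr hr1
    have h2 := h.comp (tendsto_id.const_mul_atTop hr)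
    have h3 : Tendsto (fun y => Real.exp (-((1 - r) * y))) atTop (𝓝 0) :=
      Real.tendsto_exp_neg_atTop_nhds_zero.comp
        (tendsto_id.const_mul_atTop (by linarith : 0 < 1 - r))
    have h4 := (h.const_mul r).sub (h2.mul h3)
    rw [mul_zero, sub_zero] at h4
    refine h4.congr fun y => ?_
    have : Real.exp (-y) = Real.exp (-(r * y)) * Real.exp (-((1 - r) * y)) := by
      rw [← Real.exp_add]; congr 1; ring
    simp only [Function.comp, id]
    rw [this]
    ring
  rw [tendsto_order]
  constructor
  · intro a ha
    obtain ⟨r, hr, hr1, har⟩ : ∃ r, 0 < r ∧ r < 1 ∧ a < r * θ := by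
      have hc : Tendsto (fun r : ℝ => r * θ) (𝓝[<] 1) (𝓝 (1 * θ)) :=
        ((continuous_id.mul continuous_const).tendsto _).mono_left nhdsWithin_le_nhds
      rw [one_mul] at hc
      obtain ⟨r, h2, h3⟩ := ((hc.eventually (lt_mem_nhds ha)).and
        (Ioo_mem_nhdsLT (zero_lt_one (α := ℝ)))).exists
      exact ⟨r, h3.1, h3.2, h2⟩
    filter_upwards [(hlim r hr hr1).eventually (lt_mem_nhds har), eventually_gt_atTop 0]
      with y hy hy0
    exact hy.trans_le (mul_le_mul_of_nonneg_right (hlow r hr hr1 y hy0) (Real.exp_pos _).le)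
  · intro a ha
    filter_upwards [h.eventually (gt_mem_nhds ha), eventually_gt_atTop 0] with y hy hy0
    exact (mul_le_mul_of_nonneg_right (hup y hy0) (Real.exp_pos _).le).trans_lt hy

theorem sum_chebyshevSum (h1 : nrm (1 : S) = 1) (y : ℝ) :
    ∑ s ∈ ball S y, logNorm s = ∑ s ∈ ball S y, chebyshevSum S (y - logNorm s) := by
  have := sum_logNorm_mul h1 y fun _ => 1
  simp only [mul_one, Finset.mul_sum] at this
  rw [this, sum_ball_comm h1 y fun d _ => vonMangoldt d]
  rfl

theorem tendsto_mul_card_ball (h1 : nrm (1 : S) = 1) {θ : ℝ}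
    (h : Tendsto (fun y => chebyshevSum S y * Real.exp (-y)) atTop (𝓝 θ)) :
    Tendsto (fun y => y * (ball S y).card / (Real.exp y * harmonicSum S y)) atTop (𝓝 θ) := by
  refine tendsto_of_abs_sub_le_mul fun η hη => ?_
  have h' : Tendsto (fun y => chebyshevSum S y / Real.exp y) atTop (𝓝 θ) := by
    simpa [Real.exp_neg, div_eq_mul_inv] using h
  have hid : Tendsto (fun y => y / Real.exp y) atTop (𝓝 0) := by
    simpa [Real.exp_neg, div_eq_mul_inv] using Real.tendsto_pow_mul_exp_neg_atTop_nhds_zero 1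
  obtain ⟨C, hC0, hC⟩ := exists_abs_sub_le
    ((summatory_mono (vonMangoldt_nonneg (S := S))).monotoneOn _)
    (fun t _ => summatory_nonneg vonMangoldt_nonneg t) (Real.exp_monotone.monotoneOn _)
    (fun t _ => (Real.exp_pos t).le) (Eventually.of_forall Real.exp_pos) h' (half_pos hη)
  obtain ⟨D, hD0, hD⟩ := exists_abs_sub_le (f := fun t => t)
    (monotone_id.monotoneOn _) (fun _ ht => ht) (Real.exp_monotone.monotoneOn _)
    (fun t _ => (Real.exp_pos t).le) (Eventually.of_forall Real.exp_pos) hid (half_pos hη)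
  refine ⟨C + D, by positivity, ?_⟩
  filter_upwards [eventually_gt_atTop 0] with y hy
  have hm : 0 < harmonicSum S y := one_pos.trans_le (one_le_harmonicSum h1 hy.le)
  have hem : 0 < Real.exp y * harmonicSum S y := mul_pos (Real.exp_pos y) hm
  have e1 : Real.exp y * harmonicSum S y = ∑ s ∈ ball S y, Real.exp (y - logNorm s) := by
    rw [harmonicSum, summatory, Finset.mul_sum]
    exact Finset.sum_congr rfl fun s _ => by rw [← Real.exp_add, sub_eq_add_neg]
  have key : |y * (ball S y).card - θ * (Real.exp y * harmonicSum S y)| ≤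
      η * (Real.exp y * harmonicSum S y) + (C + D) * (ball S y).card := by
    have e2 : y * (ball S y).card - θ * (Real.exp y * harmonicSum S y) =
        ∑ s ∈ ball S y, ((chebyshevSum S (y - logNorm s) - θ * Real.exp (y - logNorm s)) +
          (y - logNorm s)) := by
      rw [Finset.sum_add_distrib, Finset.sum_sub_distrib, ← sum_chebyshevSum h1, e1,
        Finset.sum_sub_distrib, Finset.sum_const, nsmul_eq_mul, Finset.mul_sum]
      ring
    rw [e2]
    calc _ ≤ ∑ s ∈ ball S y, (η * Real.exp (y - logNorm s) + (C + D)) := by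
          refine (Finset.abs_sum_le_sum_abs _ _).trans (Finset.sum_le_sum fun s hs => ?_)
          have h0 := sub_nonneg.2 (mem_ball.1 hs)
          refine (abs_add_le _ _).trans ?_
          have h2 : |chebyshevSum S (y - logNorm s) - θ * Real.exp (y - logNorm s)| ≤ _ :=
            hC _ h0
          have h3 := hD _ h0
          simp only [zero_mul, sub_zero] at h3
          linarith
      _ = _ := by
          rw [Finset.sum_add_distrib, ← Finset.mul_sum, ← e1, Finset.sum_const, nsmul_eq_mul,
            mul_comm (C + D)]
  rw [abs_of_nonneg (div_nonneg (by positivity) hem.le),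
    show y * (ball S y).card / (Real.exp y * harmonicSum S y) - θ =
      (y * (ball S y).card - θ * (Real.exp y * harmonicSum S y)) /
        (Real.exp y * harmonicSum S y) by field_simp, abs_div, abs_of_pos hem, div_le_iff₀ hem]
  refine key.trans (le_of_eq ?_)
  field_simp

theorem regularGrowth_of_tendsto_primeBall (h1 : nrm (1 : S) = 1) {θ : ℝ} (hθ : 0 < θ)
    (h : Tendsto (fun y => y * (primeBall S y).card * Real.exp (-y)) atTop (𝓝 θ)) :
    RegularGrowth S θ := by
  have hψ := tendsto_chebyshevSum h1 h
  have hM : Tendsto (fun y => mertensSum S y / y) atTop (𝓝 θ) :=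
    tendsto_summatory_mul_exp_neg h1 vonMangoldt_nonneg hψ
  exact ⟨h1, tendsto_primeMertensSum h1 hM, tendsto_mul_card_ball h1 hψ,
    fun r hr hr1 => tendsto_harmonicSum_ratio h1 hθ hM hr hr1⟩

theorem card_primeBall_log (h1 : nrm (1 : S) = 1) {x : ℝ} (hx : 0 < x) :
    (primeBall S (Real.log x)).card = primeCount S x := by
  rw [primeCount, ← Set.ncard_coe_finset]
  congr 1
  ext p
  simp only [Finset.mem_coe, mem_primeBall, Set.mem_ofPred_eq, logNorm]
  rw [Real.log_le_log_iff (one_pos.trans_le (one_le_nrm h1 p)) hx, and_comm]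

theorem card_ball_log (h1 : nrm (1 : S) = 1) {x : ℝ} (hx : 0 < x) :
    (ball S (Real.log x)).card = elementCount S x := by
  rw [elementCount, ← Set.ncard_coe_finset]
  congr 1
  ext p
  simp only [Finset.mem_coe, mem_ball, Set.mem_ofPred_eq, logNorm]
  rw [Real.log_le_log_iff (one_pos.trans_le (one_le_nrm h1 p)) hx]

theorem nrm_one_of_not_bddAbove
    (h : ∀ B : ℕ, ∃ x : ℝ, B < elementCount S x) : nrm (1 : S) = 1 := by
  refine nrm_one_eq_zero_or_one.resolve_left fun h0 => ?_
  have hz : ∀ s : S, nrm s = 0 := fun s => by rw [← mul_one s, nrm_mul, h0, mul_zero]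
  obtain ⟨x, hx⟩ := h (elementCount S 0)
  refine hx.not_ge (Set.ncard_le_ncard (fun s _ => ?_) (finite_nrm_le 0))
  exact (hz s).le

theorem primeCount_le_elementCount (x : ℝ) : primeCount S x ≤ elementCount S x :=
  Set.ncard_le_ncard (fun _ hp => hp.2) (finite_nrm_le x)

theorem regularGrowth_of_primeGrowth {θ : ℝ} (hθ : 0 < θ) (h : PrimeGrowth S θ) :
    RegularGrowth S θ := by
  obtain ⟨ε, hε, E, hE, hev⟩ := h
  have hE0 : Tendsto E atTop (𝓝 0) :=
    hE.trans_tendsto ((tendsto_rpow_neg_atTop hε).comp Real.tendsto_log_atTop)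
  have hlim : Tendsto (fun x => Real.log x * primeCount S x / x) atTop (𝓝 θ) := by
    have : Tendsto (fun x => θ * (1 + E x)) atTop (𝓝 (θ * (1 + 0))) :=
      (hE0.const_add 1).const_mul θ
    rw [add_zero, mul_one] at this
    refine this.congr' ?_
    filter_upwards [hev, eventually_gt_atTop 1] with x hx hx1
    have := Real.log_pos hx1
    rw [hx]
    field_simp
  have h1 : nrm (1 : S) = 1 := by
    refine nrm_one_of_not_bddAbove fun B => ?_
    by_contra! hB
    have h0 : Tendsto (fun x => Real.log x * B / x) atTop (𝓝 0) := by
      have := (Real.isLittleO_log_id_atTop.tendsto_div_nhds_zero).mul_const (B : ℝ)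
      rw [zero_mul] at this
      refine this.congr fun x => ?_
      simp only [id]
      ring
    refine hθ.not_ge (le_of_tendsto_of_tendsto hlim h0 ?_)
    filter_upwards [eventually_gt_atTop 1] with x hx
    have := Real.log_pos hx
    have hB' : (primeCount S x : ℝ) ≤ B := by
      exact_mod_cast (primeCount_le_elementCount x).trans (hB x)
    gcongr
  refine regularGrowth_of_tendsto_primeBall h1 hθ ?_
  refine (hlim.comp Real.tendsto_exp_atTop).congr fun y => ?_
  simp only [Function.comp]
  rw [← card_primeBall_log h1 (Real.exp_pos y), Real.log_exp, Real.exp_neg, div_eq_mul_inv]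

theorem tendsto_div_of_integral {M K : ℝ → ℝ} (hMK : ∀ y z, M y * (z - y) ≤ K z - K y)
    (hK : Tendsto (fun y => K y / y ^ 2) atTop (𝓝 (1 / 2))) :
    Tendsto (fun y => M y / y) atTop (𝓝 1) := by
  have hKr : ∀ r : ℝ, 0 < r → Tendsto (fun y => K (r * y) / y ^ 2) atTop (𝓝 (r ^ 2 / 2)) := by
    intro r hr
    have := (hK.comp (tendsto_id.const_mul_atTop hr)).const_mul (r ^ 2)
    rw [mul_one_div] at this
    refine this.congr fun y => ?_
    simp only [Function.comp, id]
    field_simp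
  refine tendsto_of_abs_sub_le fun η hη => ⟨0, ?_⟩
  obtain ⟨h, hh0, hh1, hhη⟩ : ∃ h : ℝ, 0 < h ∧ h < 1 ∧ h < η :=
    ⟨min (1 / 2) (η / 2), by positivity, (min_le_left _ _).trans_lt (by norm_num),
      (min_le_right _ _).trans_lt (by linarith)⟩
  have hup := ((hKr (1 + h) (by linarith)).sub hK).div_const h
  have hlow := (hK.sub (hKr (1 - h) (by linarith))).div_const h
  rw [show ((1 + h) ^ 2 / 2 - 1 / 2) / h = 1 + h / 2 by field_simp; ring] at hup
  rw [show (1 / 2 - (1 - h) ^ 2 / 2) / h = 1 - h / 2 by field_simp; ring] at hlow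
  filter_upwards [hup.eventually (gt_mem_nhds (by linarith : 1 + h / 2 < 1 + η)),
    hlow.eventually (lt_mem_nhds (by linarith : 1 - η < 1 - h / 2)), eventually_gt_atTop 0]
    with y hy1 hy2 hy
  rw [← sub_div, div_div, div_lt_iff₀ (by positivity)] at hy1
  rw [← sub_div, div_div, lt_div_iff₀ (by positivity)] at hy2
  have e1 := hMK y ((1 + h) * y)
  have e2 := hMK y ((1 - h) * y)
  have hhy : 0 < h * y := by positivity
  have e3 : M y < (1 + η) * y := by
    by_contra! hc
    nlinarith [mul_le_mul_of_nonneg_right hc hhy.le]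
  have e4 : (1 - η) * y < M y := by
    by_contra! hc
    nlinarith [mul_le_mul_of_nonneg_right hc hhy.le]
  rw [zero_div, add_zero, show M y / y - 1 = (M y - y) / y by field_simp, abs_div, abs_of_pos hy,
    div_le_iff₀ hy, abs_le]
  constructor <;> linarith

/-- `∑_{|d| ≤ e^y} Λ(d) (y - log |d|) / |d|`. -/
def mertensIntegral (S : Type*) [NormedArithmeticSemigroup S] (y : ℝ) : ℝ :=
  ∑ d ∈ ball S y, vonMangoldt d * Real.exp (-logNorm d) * (y - logNorm d)

theorem mertensSum_mul_le (y z : ℝ) :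
    mertensSum S y * (z - y) ≤ mertensIntegral S z - mertensIntegral S y := by
  have h0 : ∀ d : S, 0 ≤ vonMangoldt d * Real.exp (-logNorm d) := fun d =>
    mul_nonneg (vonMangoldt_nonneg d) (Real.exp_pos _).le
  have e : mertensSum S y * (z - y) + mertensIntegral S y =
      ∑ d ∈ ball S y, vonMangoldt d * Real.exp (-logNorm d) * (z - logNorm d) := by
    rw [mertensSum, summatory, mertensIntegral, Finset.sum_mul, ← Finset.sum_add_distrib]
    exact Finset.sum_congr rfl fun d _ => by ring
  rw [le_sub_iff_add_le, e, mertensIntegral]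
  rcases le_total y z with h | h
  · exact Finset.sum_le_sum_of_subset_of_nonneg (ball_mono h)
      fun d hd _ => mul_nonneg (h0 d) (sub_nonneg.2 (mem_ball.1 hd))
  · rw [← Finset.sum_sdiff (ball_mono h)]
    refine add_le_of_nonpos_left (Finset.sum_nonpos fun d hd => ?_)
    simp only [Finset.mem_sdiff, mem_ball, not_le] at hd
    exact mul_nonpos_of_nonneg_of_nonpos (h0 d) (by linarith)

theorem abs_harmonicIntegral_sub_le (h1 : nrm (1 : S) = 1) {A η C : ℝ}
    (hC : ∀ t, 0 ≤ t → |harmonicSum S t - A * t| ≤ η * t + C) {y : ℝ} (hy : 0 ≤ y) :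
    |harmonicIntegral S y - A * (y ^ 2 / 2)| ≤ η * (y ^ 2 / 2) + C * y := by
  obtain ⟨i1, i2⟩ := intervalIntegrable_summatory_mul h1 (fun s : S => Real.exp (-logNorm s))
    (F := fun t => t) (F' := fun _ => 1) (fun t => hasDerivAt_id t) continuous_const hy
  simp only [mul_one] at i1 i2
  have hid : IntervalIntegrable (fun t : ℝ => t) volume 0 y := continuous_id.intervalIntegrable _ _
  have e : harmonicIntegral S y - A * (y ^ 2 / 2) =
      ∫ t in (0 : ℝ)..y, (harmonicSum S t - A * t) := by
    have := intervalIntegral.integral_sub i1 (hid.const_mul A)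
    rw [i2, intervalIntegral.integral_const_mul, integral_id] at this
    simp only [harmonicSum, harmonicIntegral, this]
    ring
  rw [e]
  calc _ ≤ ∫ t in (0 : ℝ)..y, |harmonicSum S t - A * t| :=
        intervalIntegral.abs_integral_le_integral_abs hy
    _ ≤ ∫ t in (0 : ℝ)..y, (η * t + C) :=
        intervalIntegral.integral_mono_on hy (i1.sub (hid.const_mul A)).abs
          ((hid.const_mul η).add intervalIntegrable_const) fun t ht => hC t ht.1
    _ = η * (y ^ 2 / 2) + C * y := by
        rw [intervalIntegral.integral_add (hid.const_mul η) intervalIntegrable_const,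
          intervalIntegral.integral_const_mul, integral_id, intervalIntegral.integral_const,
          smul_eq_mul]
        ring

theorem tendsto_mertensSum_of_harmonicSum (h1 : nrm (1 : S) = 1) {A : ℝ} (hA : 0 < A)
    (hm : Tendsto (fun y => harmonicSum S y / y) atTop (𝓝 A)) :
    Tendsto (fun y => mertensSum S y / y) atTop (𝓝 1) := by
  have hbound : ∀ η > 0, ∃ C, 0 ≤ C ∧ ∀ t, 0 ≤ t → |harmonicSum S t - A * t| ≤ η * t + C :=
    fun η hη => exists_abs_sub_mul_id_le harmonicSum_mono
      (fun t => summatory_nonneg (fun _ => (Real.exp_pos _).le) t) hm hη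
  let J : ℝ → ℝ := fun y => y * harmonicSum S y - harmonicIntegral S y
  have hJ : ∀ η C, (∀ t, 0 ≤ t → |harmonicSum S t - A * t| ≤ η * t + C) → ∀ y, 0 ≤ y →
      |J y - A * (y ^ 2 / 2)| ≤ 3 / 2 * η * y ^ 2 + 2 * C * y := by
    intro η C hC y hy
    have e1 := abs_harmonicIntegral_sub_le h1 hC hy
    have e2 := mul_le_mul_of_nonneg_left (hC y hy) hy
    rw [← abs_of_nonneg hy, ← abs_mul, abs_of_nonneg hy] at e2
    have e3 : J y - A * (y ^ 2 / 2) = y * (harmonicSum S y - A * y) -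
        (harmonicIntegral S y - A * (y ^ 2 / 2)) := by simp only [J]; ring
    rw [e3]
    exact (abs_sub _ _).trans (by nlinarith)
  obtain ⟨B, hB0, hB⟩ : ∃ B, 0 ≤ B ∧ ∀ᶠ y in atTop, mertensSum S y ≤ B * y := by
    obtain ⟨C, hC0, hC⟩ := hbound 1 one_pos
    refine ⟨(2 * A + 6 + 4 * C) / (A / 2), by positivity, ?_⟩
    filter_upwards [hm.eventually (lt_mem_nhds (half_lt_self hA)), eventually_ge_atTop 1]
      with y hy hy1
    have hy0 : 0 < y := by linarith
    rw [lt_div_iff₀ hy0] at hy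
    have e1 : mertensSum S y * harmonicSum S y ≤ J (2 * y) := by
      simp only [J]
      rw [sum_logNorm_mul_exp_neg h1, mertensSum, summatory, Finset.sum_mul]
      refine (Finset.sum_le_sum fun d hd => ?_).trans
        (Finset.sum_le_sum_of_subset_of_nonneg (ball_mono (by linarith : y ≤ 2 * y))
          fun d _ _ => mul_nonneg (mul_nonneg (vonMangoldt_nonneg d) (Real.exp_pos _).le)
            (summatory_nonneg (fun _ => (Real.exp_pos _).le) _))
      refine mul_le_mul_of_nonneg_left (harmonicSum_mono ?_)
        (mul_nonneg (vonMangoldt_nonneg d) (Real.exp_pos _).le)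
      linarith [mem_ball.1 hd]
    have e2 := (abs_le.1 (hJ 1 C hC (2 * y) (by linarith))).2
    have e3 := mul_le_mul_of_nonneg_left hy.le (mertensSum_nonneg (S := S) y)
    have e4 : mertensSum S y * (A / 2) * y ≤ (2 * A + 6 + 4 * C) * y * y := by
      nlinarith [mul_le_mul_of_nonneg_left hy1 (mul_nonneg hC0 hy0.le)]
    have e5 := le_of_mul_le_mul_right e4 hy0
    rw [div_mul_eq_mul_div, le_div_iff₀ (half_pos hA)]
    exact e5
  refine tendsto_div_of_integral mertensSum_mul_le ?_
  refine tendsto_of_abs_sub_le fun η hη => ?_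
  obtain ⟨ε, hε, hεη⟩ : ∃ ε > 0, (3 / 2 + B) * ε ≤ η * A := by
    refine ⟨η * A / (3 / 2 + B), by positivity, le_of_eq ?_⟩
    field_simp
  obtain ⟨C, hC0, hC⟩ := hbound ε hε
  refine ⟨(2 * C + C * B) / A, ?_⟩
  filter_upwards [hB, eventually_gt_atTop 0] with y hyB hy
  have e1 := hJ ε C hC y hy.le
  have e2 : |J y - A * mertensIntegral S y| ≤ (ε * y + C) * (B * y) := by
    have : J y - A * mertensIntegral S y = ∑ d ∈ ball S y, vonMangoldt d *
        Real.exp (-logNorm d) * (harmonicSum S (y - logNorm d) - A * (y - logNorm d)) := by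
      simp only [J]
      rw [sum_logNorm_mul_exp_neg h1, mertensIntegral, Finset.mul_sum, ← Finset.sum_sub_distrib]
      exact Finset.sum_congr rfl fun d _ => by ring
    rw [this]
    calc _ ≤ ∑ d ∈ ball S y, vonMangoldt d * Real.exp (-logNorm d) * (ε * y + C) := by
          refine (Finset.abs_sum_le_sum_abs _ _).trans (Finset.sum_le_sum fun d hd => ?_)
          have h0 := mul_nonneg (vonMangoldt_nonneg d) (Real.exp_pos (-logNorm d)).le
          rw [abs_mul, abs_of_nonneg h0]
          refine mul_le_mul_of_nonneg_left ((hC _ (sub_nonneg.2 (mem_ball.1 hd))).trans ?_) h0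
          nlinarith [logNorm_nonneg h1 d]
      _ = (ε * y + C) * mertensSum S y := by
          rw [← Finset.sum_mul, mertensSum, summatory, mul_comm]
      _ ≤ _ := by gcongr
  have e3 : |mertensIntegral S y / y ^ 2 - 1 / 2| * (A * y ^ 2) ≤
      ((3 / 2 + B) * ε) * y ^ 2 + (2 * C + C * B) * y := by
    rw [← abs_of_pos (by positivity : 0 < A * y ^ 2), ← abs_mul]
    have : (mertensIntegral S y / y ^ 2 - 1 / 2) * (A * y ^ 2) =
        (J y - A * (y ^ 2 / 2)) - (J y - A * mertensIntegral S y) := by field_simp; ring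
    rw [this]
    exact (abs_sub _ _).trans (by nlinarith)
  refine le_of_mul_le_mul_right (e3.trans ?_) (by positivity : 0 < A * y ^ 2)
  have e4 : (η + (2 * C + C * B) / A / y) * (A * y ^ 2) =
      η * A * y ^ 2 + (2 * C + C * B) * y := by field_simp
  rw [e4]
  gcongr

theorem regularGrowth_of_tendsto_ball (h1 : nrm (1 : S) = 1) {A : ℝ} (hA : 0 < A)
    (h : Tendsto (fun y => (ball S y).card * Real.exp (-y)) atTop (𝓝 A)) :
    RegularGrowth S 1 := by
  have hm : Tendsto (fun y => harmonicSum S y / y) atTop (𝓝 A) := by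
    have := tendsto_summatory_mul_exp_neg h1 (w := fun _ : S => 1) (fun _ => zero_le_one)
      (c := A) (by simpa [summatory] using h)
    simpa [harmonicSum] using this
  refine ⟨h1, tendsto_primeMertensSum h1 (tendsto_mertensSum_of_harmonicSum h1 hA hm), ?_,
    fun r hr hr1 => ?_⟩
  · have := h.div hm hA.ne'
    rw [div_self hA.ne'] at this
    refine this.congr' ?_
    filter_upwards [eventually_gt_atTop 0] with y hy
    have := (one_pos.trans_le (one_le_harmonicSum h1 hy.le)).ne'
    rw [Pi.div_apply, Real.exp_neg]
    field_simp
  · have := ((hm.comp (tendsto_id.const_mul_atTop hr)).div hm hA.ne').const_mul r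
    rw [div_self hA.ne', mul_one] at this
    rw [Real.rpow_one]
    refine this.congr' ?_
    filter_upwards [eventually_gt_atTop 0] with y hy
    have := (one_pos.trans_le (one_le_harmonicSum h1 hy.le)).ne'
    simp only [Function.comp, id, Pi.div_apply]
    field_simp

theorem regularGrowth_of_linearGrowth (h : LinearGrowth S) : RegularGrowth S 1 := by
  obtain ⟨A, δ, hA, hδ, E, hE, hev⟩ := h
  have hE0 : Tendsto E atTop (𝓝 0) := hE.trans_tendsto (tendsto_rpow_neg_atTop hδ)
  have hlim : Tendsto (fun x => (elementCount S x : ℝ) / x) atTop (𝓝 A) := by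
    have : Tendsto (fun x => A * (1 + E x)) atTop (𝓝 (A * (1 + 0))) :=
      (hE0.const_add 1).const_mul A
    rw [add_zero, mul_one] at this
    refine this.congr' ?_
    filter_upwards [hev, eventually_gt_atTop 0] with x hx hx1
    rw [hx]
    field_simp
  have h1 : nrm (1 : S) = 1 := by
    refine nrm_one_of_not_bddAbove fun B => ?_
    by_contra! hB
    have h0 : Tendsto (fun x : ℝ => (B : ℝ) / x) atTop (𝓝 0) :=
      tendsto_const_nhds.div_atTop tendsto_id
    refine hA.not_ge (le_of_tendsto_of_tendsto hlim h0 ?_)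
    filter_upwards [eventually_gt_atTop 0] with x hx
    have hB' : (elementCount S x : ℝ) ≤ B := by exact_mod_cast hB x
    gcongr
  refine regularGrowth_of_tendsto_ball h1 hA ?_
  refine (hlim.comp Real.tendsto_exp_atTop).congr fun y => ?_
  simp only [Function.comp]
  rw [← card_ball_log h1 (Real.exp_pos y), Real.log_exp, Real.exp_neg, div_eq_mul_inv]

/-- The lower limit of `f` at infinity is at least `c`. -/
def LiminfGE (f : ℝ → ℝ) (c : ℝ) : Prop := ∀ c' < c, ∀ᶠ y in atTop, c' < f y

theorem LiminfGE.of_tendsto {f : ℝ → ℝ} {c : ℝ} (h : Tendsto f atTop (𝓝 c)) : LiminfGE f c :=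
  fun _ hc => h.eventually (lt_mem_nhds hc)

theorem LiminfGE.mono {f g : ℝ → ℝ} {c : ℝ} (h : LiminfGE f c) (hfg : ∀ᶠ y in atTop, f y ≤ g y) :
    LiminfGE g c := fun c' hc => by
  filter_upwards [h c' hc, hfg] with y h1 h2 using h1.trans_le h2

theorem LiminfGE.add {f g : ℝ → ℝ} {c d : ℝ} (hf : LiminfGE f c) (hg : LiminfGE g d) :
    LiminfGE (fun y => f y + g y) (c + d) := fun x hx => by
  filter_upwards [hf (c - (c + d - x) / 2) (by linarith), hg (d - (c + d - x) / 2) (by linarith)]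
    with y h1 h2
  linarith

theorem LiminfGE.sum {ι : Type*} (s : Finset ι) {f : ι → ℝ → ℝ} {c : ι → ℝ}
    (h : ∀ i ∈ s, LiminfGE (f i) (c i)) :
    LiminfGE (fun y => ∑ i ∈ s, f i y) (∑ i ∈ s, c i) := by
  induction s using Finset.induction_on with
  | empty =>
    simp only [Finset.sum_empty]
    exact .of_tendsto tendsto_const_nhds
  | insert i s hi ih =>
    simp only [Finset.sum_insert hi]
    exact (h i (by simp)).add (ih fun j hj => h j (by simp [hj]))

/-- A lower limit which is at least every `u`, for `u` tending to `c`, is at least `c`. -/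
theorem LiminfGE.of_tendsto_bound {ι : Type*} {l : Filter ι} [l.NeBot] {f : ℝ → ℝ} {c : ℝ}
    {u : ι → ℝ} (hu : Tendsto u l (𝓝 c)) (h : ∀ᶠ i in l, LiminfGE f (u i)) : LiminfGE f c :=
  fun _ hc => by
    obtain ⟨i, h1, h2⟩ := (h.and (hu.eventually (lt_mem_nhds hc))).exists
    exact h1 _ h2

/-- The primes `p` with `a y < log |p| ≤ b y`. -/
def primeInterval (S : Type*) [NormedArithmeticSemigroup S] (y a b : ℝ) : Finset S :=
  (primeBall S (b * y)).filter fun p => a * y < logNorm p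

theorem mem_primeInterval {y a b : ℝ} {p : S} :
    p ∈ primeInterval S y a b ↔ (logNorm p ≤ b * y ∧ Irreducible p) ∧ a * y < logNorm p := by
  simp [primeInterval]

/-- The mass given to `(a, b]` by the main part of the law of the first size-biased factor. -/
def primeWeight (S : Type*) [NormedArithmeticSemigroup S] (y a b : ℝ) : ℝ :=
  ∑ p ∈ primeInterval S y a b,
    logNorm p / y * ((ball S (y - logNorm p)).card / (ball S y).card)

theorem primeWeight_add (a b c : ℝ) (hab : a ≤ b) (hbc : b ≤ c) {y : ℝ} (hy : 0 ≤ y) :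
    primeWeight S y a b + primeWeight S y b c = primeWeight S y a c := by
  have h1 := mul_le_mul_of_nonneg_right hab hy
  have h2 := mul_le_mul_of_nonneg_right hbc hy
  unfold primeWeight
  rw [← Finset.sum_union]
  · congr 1
    ext p
    simp only [Finset.mem_union, mem_primeInterval]
    constructor
    · rintro (⟨⟨h, hp⟩, h'⟩ | ⟨⟨h, hp⟩, h'⟩)
      · exact ⟨⟨by linarith, hp⟩, h'⟩
      · exact ⟨⟨h, hp⟩, by linarith⟩
    · rintro ⟨⟨h, hp⟩, h'⟩
      rcases le_or_gt (logNorm p) (b * y) with h3 | h3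
      · exact Or.inl ⟨⟨h3, hp⟩, h'⟩
      · exact Or.inr ⟨⟨h, hp⟩, h3⟩
  · rw [Finset.disjoint_left]
    intro p hp hp'
    rw [mem_primeInterval] at hp hp'
    linarith [hp.1.1, hp'.2]

theorem primeWeight_self (a y : ℝ) : primeWeight S y a a = 0 := by
  refine Finset.sum_eq_zero fun p hp => ?_
  rw [mem_primeInterval] at hp
  linarith [hp.1.1, hp.2]

theorem sum_primeInterval (a b : ℝ) (hab : a ≤ b) {y : ℝ} (hy : 0 ≤ y) :
    ∑ p ∈ primeInterval S y a b, logNorm p * Real.exp (-logNorm p) =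
      primeMertensSum S (b * y) - primeMertensSum S (a * y) := by
  have hsub := primeBall_mono (S := S) (mul_le_mul_of_nonneg_right hab hy)
  rw [primeMertensSum, primeMertensSum, ← Finset.sum_sdiff hsub, add_sub_cancel_right]
  congr 1
  ext p
  simp only [mem_primeInterval, Finset.mem_sdiff, mem_primeBall, not_and, ← not_le]
  tauto

theorem card_ball_pos (h1 : nrm (1 : S) = 1) {y : ℝ} (hy : 0 ≤ y) :
    (0 : ℝ) < (ball S y).card := by
  exact_mod_cast Finset.card_pos.2 ⟨1, mem_ball.2 (by rwa [logNorm_one h1])⟩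

theorem RegularGrowth.tendsto_primeMertensSum_mul {θ : ℝ} (h : RegularGrowth S θ) {r : ℝ}
    (hr : 0 ≤ r) : Tendsto (fun y => primeMertensSum S (r * y) / y) atTop (𝓝 (r * θ)) := by
  rcases hr.eq_or_lt with rfl | hr
  · simp only [zero_mul]
    exact tendsto_const_nhds.div_atTop tendsto_id
  · refine ((h.primes.comp (tendsto_id.const_mul_atTop hr)).const_mul r).congr fun y => ?_
    simp only [Function.comp, id]
    field_simp

theorem RegularGrowth.liminfGE_primeWeight_short {θ : ℝ} (h : RegularGrowth S θ) (hθ : 0 < θ)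
    {a b : ℝ} (ha : 0 ≤ a) (hab : a < b) (hb : b < 1) :
    LiminfGE (fun y => primeWeight S y a b) (θ * (b - a) * (1 - b) ^ θ / (1 - a)) := by
  have h1 := h.nrm_one
  set c := θ * (b - a) * (1 - b) ^ θ / (1 - a)
  have hc : Tendsto (fun u : ℝ => u * u * c) (𝓝[<] 1) (𝓝 c) := by
    have : Tendsto (fun u : ℝ => u * u * c) (𝓝 1) (𝓝 (1 * 1 * c)) := by
      apply Continuous.tendsto; fun_prop
    rw [one_mul, one_mul] at this
    exact this.mono_left nhdsWithin_le_nhds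
  refine LiminfGE.of_tendsto_bound hc ?_
  filter_upwards [Ioo_mem_nhdsLT (zero_lt_one (α := ℝ))] with u ⟨hu0, hu1⟩
  have hlim : Tendsto (fun y => u * u * (((primeMertensSum S (b * y) / y -
      primeMertensSum S (a * y) / y) * (harmonicSum S ((1 - b) * y) / harmonicSum S y)) /
        (1 - a))) atTop (𝓝 (u * u * c)) := by
    have e : c = (b * θ - a * θ) * (1 - b) ^ θ / (1 - a) := by simp only [c]; ring
    rw [e]
    exact ((((h.tendsto_primeMertensSum_mul (ha.trans hab.le)).sub
      (h.tendsto_primeMertensSum_mul ha)).mul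
        (h.harmonic (1 - b) (by linarith) (by linarith))).div_const _).const_mul _
  refine (LiminfGE.of_tendsto hlim).mono ?_
  set q : ℝ → ℝ := fun y => y * (ball S y).card / (Real.exp y * harmonicSum S y) with hq
  have hqlow := h.count.eventually (lt_mem_nhds (show u * θ < θ by nlinarith))
  have hqup := h.count.eventually
    (gt_mem_nhds (show θ < θ / u by rw [lt_div_iff₀ hu0]; nlinarith))
  obtain ⟨T, hT⟩ := eventually_atTop.1 hqlow
  filter_upwards [hqup, eventually_gt_atTop 0, eventually_ge_atTop (T / (1 - b))]
    with y hqy hy hyT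
  have hTy : T ≤ (1 - b) * y := by rw [div_le_iff₀ (by linarith)] at hyT; linarith
  have hmpos : ∀ z, 0 ≤ z → 0 < harmonicSum S z := fun z hz =>
    one_pos.trans_le (one_le_harmonicSum h1 hz)
  have hby : 0 < (1 - b) * y := mul_pos (by linarith) hy
  have e0 : ∀ z, 0 < z → ((ball S z).card : ℝ) = Real.exp z * harmonicSum S z * q z / z := by
    intro z hz
    have := (hmpos z hz.le).ne'
    simp only [hq]
    field_simp
  have key : ∀ p ∈ primeInterval S y a b,
      u * u * (harmonicSum S ((1 - b) * y) / harmonicSum S y) / (1 - a) / y *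
        (logNorm p * Real.exp (-logNorm p)) ≤
      logNorm p / y * ((ball S (y - logNorm p)).card / (ball S y).card) := by
    intro p hp
    rw [mem_primeInterval] at hp
    have hz1 : (1 - b) * y ≤ y - logNorm p := by linarith [hp.1.1]
    have hz2 : y - logNorm p ≤ (1 - a) * y := by linarith [hp.2]
    set z := y - logNorm p with hz
    have hz0 : 0 < z := hby.trans_le hz1
    have hqz : u * θ < q z := hT z (hTy.trans hz1)
    have hm := harmonicSum_mono (S := S) hz1
    have hmy := hmpos y hy.le
    have hmb := hmpos _ hby.le
    have hqz0 : 0 < q z := (mul_pos hu0 hθ).trans hqz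
    have hqy0 : 0 < q y := div_pos (mul_pos hy (card_ball_pos h1 hy.le))
      (mul_pos (Real.exp_pos y) hmy)
    have hqq : u * u ≤ q z / q y := by
      rw [le_div_iff₀ hqy0]
      change q y < θ / u at hqy
      rw [lt_div_iff₀ hu0] at hqy
      nlinarith
    have hexp : Real.exp (-logNorm p) = Real.exp z / Real.exp y := by
      rw [← Real.exp_sub]; congr 1; rw [hz]; ring
    have hyz : 1 / (1 - a) ≤ y / z := by
      rw [div_le_div_iff₀ (by linarith) hz0]; linarith
    have hl : 0 ≤ logNorm p := logNorm_nonneg h1 p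
    have hr : ((ball S z).card : ℝ) / (ball S y).card =
        Real.exp (-logNorm p) * ((q z / q y) * (harmonicSum S z / harmonicSum S y) *
          (y / z)) := by
      rw [e0 z hz0, e0 y hy, hexp]
      field_simp
    rw [hr]
    have ha1 : 0 < 1 - a := by linarith
    calc _ = logNorm p / y * (Real.exp (-logNorm p) * (u * u *
          (harmonicSum S ((1 - b) * y) / harmonicSum S y) * (1 / (1 - a)))) := by
          ring
      _ ≤ _ := by
          refine mul_le_mul_of_nonneg_left (mul_le_mul_of_nonneg_left
            (mul_le_mul (mul_le_mul hqq (div_le_div_of_nonneg_right hm hmy.le)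
              (div_pos hmb hmy).le (div_pos hqz0 hqy0).le) hyz (by positivity) ?_)
            (Real.exp_pos _).le) (div_nonneg hl hy.le)
          exact mul_nonneg (div_pos hqz0 hqy0).le (div_pos (hmb.trans_le hm) hmy).le
  calc _ = u * u * (harmonicSum S ((1 - b) * y) / harmonicSum S y) / (1 - a) / y *
        ∑ p ∈ primeInterval S y a b, logNorm p * Real.exp (-logNorm p) := by
        rw [sum_primeInterval a b hab.le hy.le]
        ring
    _ ≤ _ := by
        rw [Finset.mul_sum]
        exact Finset.sum_le_sum key

theorem tendsto_mul_sub_div_one_sub_rpow {θ : ℝ} (hθ : 0 < θ) :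
    Tendsto (fun ρ : ℝ => θ * ρ ^ θ * (1 - ρ) / (1 - ρ ^ θ)) (𝓝[<] 1) (𝓝 1) := by
  have hd : HasDerivAt (fun x : ℝ => x ^ θ) θ 1 := by
    simpa using Real.hasDerivAt_rpow_const (x := 1) (p := θ) (Or.inl one_ne_zero)
  have hs := (hasDerivAt_iff_tendsto_slope.1 hd).mono_left
    (nhdsWithin_mono (1 : ℝ) (fun x (hx : x < 1) => hx.ne))
  have hc : Tendsto (fun ρ : ℝ => ρ ^ θ) (𝓝[<] 1) (𝓝 1) := by
    have := hd.continuousAt.tendsto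
    rw [Real.one_rpow] at this
    exact this.mono_left nhdsWithin_le_nhds
  have := (hc.const_mul θ).div hs hθ.ne'
  rw [mul_one, div_self hθ.ne'] at this
  refine this.congr' ?_
  filter_upwards [Ioo_mem_nhdsLT (zero_lt_one (α := ℝ))] with ρ ⟨h0, h1⟩
  have h2 : ρ ^ θ < 1 := Real.rpow_lt_one h0.le h1 hθ
  have h3 : ρ ^ θ - 1 ≠ 0 := by linarith
  have h4 : 1 - ρ ^ θ ≠ 0 := by linarith
  have h5 : ρ - 1 ≠ 0 := by linarith
  simp only [Pi.div_apply, slope_def_field, Real.one_rpow]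
  rw [div_div_eq_mul_div, div_eq_div_iff h3 h4]
  ring

theorem RegularGrowth.liminfGE_primeWeight {θ : ℝ} (h : RegularGrowth S θ) (hθ : 0 < θ)
    {a b : ℝ} (ha : 0 ≤ a) (hab : a < b) (hb : b < 1) :
    LiminfGE (fun y => primeWeight S y a b) ((1 - a) ^ θ - (1 - b) ^ θ) := by
  have ha1 : 0 < 1 - a := by linarith
  have hb1 : 0 < 1 - b := by linarith
  have hpow : ∀ ρ, 0 < ρ → ρ < 1 → ∀ n : ℕ, LiminfGE
      (fun y => primeWeight S y a (1 - (1 - a) * ρ ^ n))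
      (θ * ρ ^ θ * (1 - ρ) / (1 - ρ ^ θ) * ((1 - a) ^ θ - ((1 - a) * ρ ^ n) ^ θ)) := by
    intro ρ hρ hρ1 n
    have hρθ : ρ ^ θ < 1 := Real.rpow_lt_one hρ.le hρ1 hθ
    induction n with
    | zero =>
      simp only [pow_zero, mul_one, sub_sub_cancel, primeWeight_self, sub_self, mul_zero]
      exact .of_tendsto tendsto_const_nhds
    | succ n ih =>
      have hn0 : 0 < ρ ^ n := pow_pos hρ n
      have hn1 : ρ ^ n ≤ 1 := pow_le_one₀ hρ.le hρ1.le
      have hs0 : 0 < (1 - a) * ρ ^ n := by positivity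
      have hlt : (1 - a) * ρ ^ (n + 1) < (1 - a) * ρ ^ n := by
        rw [pow_succ]; nlinarith
      have hs1 : 0 < (1 - a) * ρ ^ (n + 1) := by positivity
      have hle : (1 - a) * ρ ^ n ≤ 1 - a := by nlinarith
      have h2 := h.liminfGE_primeWeight_short hθ (a := 1 - (1 - a) * ρ ^ n)
        (b := 1 - (1 - a) * ρ ^ (n + 1)) (by linarith) (by linarith) (by linarith)
      have h3 := (ih.add h2).mono (g := fun y => primeWeight S y a (1 - (1 - a) * ρ ^ (n + 1)))
        (by filter_upwards [eventually_ge_atTop 0] with y hy using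
          (primeWeight_add _ _ _ (by linarith) (by linarith) hy).le)
      convert h3 using 1
      have e : ((1 - a) * ρ ^ (n + 1)) ^ θ = ((1 - a) * ρ ^ n) ^ θ * ρ ^ θ := by
        rw [pow_succ, ← mul_assoc, Real.mul_rpow hs0.le hρ.le]
      simp only [sub_sub_cancel]
      rw [e, pow_succ]
      have h4 : 1 - ρ ^ θ ≠ 0 := by linarith
      have h5 : ρ ^ n ≠ 0 := hn0.ne'
      field_simp
      ring
  have hρ0 : 0 < (1 - b) / (1 - a) := div_pos hb1 ha1
  have hρ1 : (1 - b) / (1 - a) < 1 := (div_lt_one ha1).2 (by linarith)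
  let ρ : ℕ → ℝ := fun n => ((1 - b) / (1 - a)) ^ (1 / ((n : ℝ) + 1))
  have hρlim : Tendsto ρ atTop (𝓝[<] 1) := by
    refine tendsto_nhdsWithin_iff.2 ⟨?_, Eventually.of_forall fun n =>
      Real.rpow_lt_one hρ0.le hρ1 (by positivity)⟩
    have := (Real.continuousAt_const_rpow hρ0.ne').tendsto.comp
      (tendsto_one_div_add_atTop_nhds_zero_nat (𝕜 := ℝ))
    rwa [Real.rpow_zero] at this
  have hlim := ((tendsto_mul_sub_div_one_sub_rpow hθ).comp hρlim).mul_const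
    ((1 - a) ^ θ - (1 - b) ^ θ)
  rw [one_mul] at hlim
  refine LiminfGE.of_tendsto_bound hlim (Eventually.of_forall fun n => ?_)
  have h2 := hpow (ρ n) (Real.rpow_pos_of_pos hρ0 _)
    (Real.rpow_lt_one hρ0.le hρ1 (by positivity)) (n + 1)
  have e : (1 - a) * ρ n ^ (n + 1) = 1 - b := by
    rw [← Real.rpow_natCast, ← Real.rpow_mul hρ0.le]
    push_cast
    rw [one_div_mul_cancel (by positivity), Real.rpow_one]
    field_simp
  rw [e, sub_sub_cancel] at h2
  exact h2

/-- Size-biased sampling without replacement from the multiset `M` of primes: the probability that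
the first `k` samples `p_0, p_1, …` satisfy `a_i y_i < log |p_i| ≤ b_i y_i`, where
`(a_i, b_i) = c i` and `y_i = y - log |p_0| - ⋯ - log |p_{i-1}|`. -/
def boxWeight : (k : ℕ) → (Fin k → ℝ × ℝ) → ℝ → Multiset S → ℝ
  | 0, _, _, _ => 1
  | k + 1, c, y, M => (M.map fun p =>
      if (c 0).1 * y < logNorm p ∧ logNorm p ≤ (c 0).2 * y then
        logNorm p / (M.map logNorm).sum *
          boxWeight k (Fin.tail c) (y - logNorm p) (M.erase p)
      else 0).sum

theorem sum_map_logNorm_nonneg (h1 : nrm (1 : S) = 1) (M : Multiset S) :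
    0 ≤ (M.map logNorm).sum :=
  Multiset.sum_nonneg fun x hx => by
    obtain ⟨p, -, rfl⟩ := Multiset.mem_map.1 hx
    exact logNorm_nonneg h1 p

theorem boxWeight_nonneg (h1 : nrm (1 : S) = 1) :
    ∀ (k : ℕ) (c : Fin k → ℝ × ℝ) (y : ℝ) (M : Multiset S), 0 ≤ boxWeight k c y M
  | 0, _, _, _ => zero_le_one
  | k + 1, c, y, M => Multiset.sum_nonneg fun x hx => by
      obtain ⟨p, -, rfl⟩ := Multiset.mem_map.1 hx
      split_ifs
      · exact mul_nonneg (div_nonneg (logNorm_nonneg h1 p) (sum_map_logNorm_nonneg h1 M))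
          (boxWeight_nonneg h1 k _ _ _)
      · exact le_rfl

/-- The interval number `j` of the subdivision of `(0, 1]` into `N` equal parts. -/
def gridInterval (N : ℕ) (j : Fin N) : ℝ × ℝ := ((j : ℕ) / N, ((j : ℕ) + 1) / N)

theorem sum_gridInterval_le (N : ℕ) {x y l : ℝ} (hx : 0 ≤ x) :
    ∑ j : Fin N, (if (gridInterval N j).1 * y < l ∧ l ≤ (gridInterval N j).2 * y then x else 0)
      ≤ x := by
  rw [← Finset.sum_filter, Finset.sum_const]
  have hcard : (Finset.univ.filter fun j : Fin N =>
      (gridInterval N j).1 * y < l ∧ l ≤ (gridInterval N j).2 * y).card ≤ 1 := by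
    have main : ∀ i j : Fin N, i < j → (gridInterval N i).1 * y < l →
        l ≤ (gridInterval N i).2 * y → (gridInterval N j).1 * y < l → False := by
      intro i j hij h1 h2 h3
      have hN : (0 : ℝ) < N := by exact_mod_cast i.pos
      simp only [gridInterval] at h1 h2 h3
      have hy : 0 < y := by
        have := h1.trans_le h2
        rw [div_mul_eq_mul_div, div_mul_eq_mul_div, div_lt_div_iff_of_pos_right hN] at this
        linarith
      have h4 := h3.trans_le h2
      rw [div_mul_eq_mul_div, div_mul_eq_mul_div, div_lt_div_iff_of_pos_right hN] at h4
      have h5 : ((i : ℕ) : ℝ) + 1 ≤ (j : ℕ) := by exact_mod_cast hij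
      nlinarith
    refine Finset.card_le_one.2 fun i hi j hj => ?_
    simp only [Finset.mem_filter, Finset.mem_univ, true_and] at hi hj
    rcases lt_trichotomy i j with h | h | h
    · exact (main i j h hi.1 hi.2 hj.1).elim
    · exact h
    · exact (main j i h hj.1 hj.2 hi.1).elim
  calc _ ≤ 1 • x := nsmul_le_nsmul_left hx hcard
    _ = x := one_nsmul x

theorem sum_boxWeight_le_one (h1 : nrm (1 : S) = 1) (N : ℕ) :
    ∀ (k : ℕ) (y : ℝ) (M : Multiset S),
      ∑ c : Fin k → Fin N, boxWeight k (fun i => gridInterval N (c i)) y M ≤ 1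
  | 0, y, M => by simp [boxWeight]
  | k + 1, y, M => by
      have ih := sum_boxWeight_le_one h1 N k
      rw [← (Fin.consEquiv fun _ : Fin (k + 1) => Fin N).sum_comp, Fintype.sum_prod_type]
      have e : ∀ (j : Fin N) (c : Fin k → Fin N),
          boxWeight (k + 1)
            (fun i => gridInterval N ((Fin.consEquiv fun _ : Fin (k + 1) => Fin N) (j, c) i)) y M =
          (M.map fun p =>
            if (gridInterval N j).1 * y < logNorm p ∧ logNorm p ≤ (gridInterval N j).2 * y then
              logNorm p / (M.map logNorm).sum *
                boxWeight k (fun i => gridInterval N (c i)) (y - logNorm p) (M.erase p)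
            else 0).sum := fun j c => rfl
      simp only [e]
      have hσ0 := sum_map_logNorm_nonneg h1 M
      generalize hσ : (M.map logNorm).sum = σ at hσ0 ⊢
      simp only [Finset.sum_multiset_map_count]
      have hle : ∀ p ∈ M.toFinset, ∑ j : Fin N, ∑ c : Fin k → Fin N, (M.count p •
          if (gridInterval N j).1 * y < logNorm p ∧ logNorm p ≤ (gridInterval N j).2 * y then
              logNorm p / σ *
                boxWeight k (fun i => gridInterval N (c i)) (y - logNorm p) (M.erase p)
            else 0) ≤ M.count p • (logNorm p / σ) := by
        intro p _
        have h0 : 0 ≤ logNorm p / σ :=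
          div_nonneg (logNorm_nonneg h1 p) hσ0
        simp only [← Finset.smul_sum]
        refine nsmul_le_nsmul_right ?_ _
        refine le_trans (Finset.sum_le_sum fun j _ => ?_)
          (sum_gridInterval_le N (y := y) (l := logNorm p) h0)
        split_ifs
        · rw [← Finset.mul_sum]
          exact mul_le_of_le_one_right h0 (ih _ _)
        · simp
      calc _ = ∑ p ∈ M.toFinset, ∑ j : Fin N, ∑ c : Fin k → Fin N, (M.count p •
          if (gridInterval N j).1 * y < logNorm p ∧ logNorm p ≤ (gridInterval N j).2 * y then
              logNorm p / σ *
                boxWeight k (fun i => gridInterval N (c i)) (y - logNorm p) (M.erase p)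
            else 0) := by
            exact (Finset.sum_congr rfl fun j _ => Finset.sum_comm).trans Finset.sum_comm
        _ ≤ ∑ p ∈ M.toFinset, M.count p • (logNorm p / σ) :=
            Finset.sum_le_sum hle
        _ = (M.map fun p => logNorm p / σ).sum :=
            (Finset.sum_multiset_map_count _ _).symm
        _ = σ / σ := by
            rw [Multiset.sum_map_div, hσ]
        _ ≤ 1 := div_self_le_one _

/-- The average of `boxWeight` over the elements `s` with `log |s| ≤ y`. -/
def boxAverage (S : Type*) [NormedArithmeticSemigroup S] (k : ℕ) (c : Fin k → ℝ × ℝ) (y : ℝ) :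
    ℝ :=
  (∑ s ∈ ball S y, boxWeight k c y (primeFactors s)) / (ball S y).card

theorem boxAverage_nonneg (h1 : nrm (1 : S) = 1) (k : ℕ) (c : Fin k → ℝ × ℝ) (y : ℝ) :
    0 ≤ boxAverage S k c y :=
  div_nonneg (Finset.sum_nonneg fun _ _ => boxWeight_nonneg h1 _ _ _ _) (Nat.cast_nonneg _)

theorem sum_primeInterval_le_boxWeight (h1 : nrm (1 : S) = 1) {k : ℕ} (c : Fin (k + 1) → ℝ × ℝ)
    {y : ℝ} {s : S} (hs : s ∈ ball S y) :
    ∑ p ∈ primeInterval S y (c 0).1 (c 0).2, (if p ∣ s then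
      logNorm p / y * boxWeight k (Fin.tail c) (y - logNorm p) ((primeFactors s).erase p) else 0) ≤
    boxWeight (k + 1) c y (primeFactors s) := by
  have hsy := mem_ball.1 hs
  rw [boxWeight, Finset.sum_multiset_map_count, ← Finset.sum_filter]
  have hdvd : ∀ p : S, Irreducible p → p ∣ s → p ∈ primeFactors s := fun p hp h => by
    rw [dvd_iff_primeFactors_le, primeFactors_prime hp] at h
    exact Multiset.singleton_le.1 h
  have hnn : ∀ p : S, 0 ≤ logNorm p / ((primeFactors s).map logNorm).sum *
      boxWeight k (Fin.tail c) (y - logNorm p) ((primeFactors s).erase p) := fun p =>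
    mul_nonneg (div_nonneg (logNorm_nonneg h1 p) (sum_map_logNorm_nonneg h1 _))
      (boxWeight_nonneg h1 _ _ _ _)
  refine (Finset.sum_le_sum fun p hp => ?_).trans
    (Finset.sum_le_sum_of_subset_of_nonneg (fun p hp => ?_) fun p _ _ => ?_)
  · simp only [Finset.mem_filter, mem_primeInterval] at hp
    obtain ⟨⟨⟨hb, hp⟩, ha⟩, hd⟩ := hp
    rw [if_pos ⟨ha, hb⟩]
    have hmem := hdvd p hp hd
    have hcount : 1 ≤ (primeFactors s).count p := Multiset.one_le_count_iff_mem.2 hmem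
    refine le_trans ?_ ((one_nsmul _).symm.le.trans (nsmul_le_nsmul_left (hnn p) hcount))
    refine mul_le_mul_of_nonneg_right ?_ (boxWeight_nonneg h1 _ _ _ _)
    rw [← logNorm_eq_sum h1]
    have hs0 : 0 < logNorm s := by
      obtain ⟨t, rfl⟩ := hd
      rw [logNorm_mul h1]
      linarith [logNorm_prime_pos hp, logNorm_nonneg h1 t]
    exact div_le_div_of_nonneg_left (logNorm_nonneg h1 p) hs0 hsy
  · simp only [Finset.mem_filter, mem_primeInterval] at hp
    exact Multiset.mem_toFinset.2 (hdvd p hp.1.1.2 hp.2)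
  · refine nsmul_nonneg ?_ _
    split_ifs
    · exact hnn p
    · exact le_rfl

theorem sum_primeInterval_le_boxAverage (h1 : nrm (1 : S) = 1) {k : ℕ}
    (c : Fin (k + 1) → ℝ × ℝ) {y : ℝ} (hy : 0 ≤ y) (hb : (c 0).2 ≤ 1) :
    ∑ p ∈ primeInterval S y (c 0).1 (c 0).2,
      logNorm p / y * ((ball S (y - logNorm p)).card / (ball S y).card) *
        boxAverage S k (Fin.tail c) (y - logNorm p) ≤ boxAverage S (k + 1) c y := by
  have hN := card_ball_pos h1 hy
  rw [boxAverage, le_div_iff₀ hN]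
  refine le_trans ?_ (Finset.sum_le_sum fun s hs => sum_primeInterval_le_boxWeight h1 c hs)
  rw [Finset.sum_comm, Finset.sum_mul]
  refine Finset.sum_le_sum fun p hp => ?_
  rw [mem_primeInterval] at hp
  rw [sum_dvd_eq h1 y p fun s => logNorm p / y *
    boxWeight k (Fin.tail c) (y - logNorm p) ((primeFactors s).erase p)]
  have he : ∀ m : S, (primeFactors (p * m)).erase p = primeFactors m := fun m => by
    rw [primeFactors_mul, primeFactors_prime hp.1.2, Multiset.singleton_add,
      Multiset.erase_cons_head]
  simp only [he]
  have hz : 0 ≤ y - logNorm p := by nlinarith [hp.1.1]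
  have hNz := card_ball_pos h1 hz
  rw [← Finset.mul_sum, boxAverage]
  refine le_of_eq ?_
  field_simp

theorem RegularGrowth.liminfGE_boxAverage {θ : ℝ} (h : RegularGrowth S θ) (hθ : 0 < θ) :
    ∀ (k : ℕ) (c : Fin k → ℝ × ℝ), (∀ i, 0 ≤ (c i).1 ∧ (c i).1 < (c i).2 ∧ (c i).2 ≤ 1) →
      LiminfGE (boxAverage S k c) (∏ i, ((1 - (c i).1) ^ θ - (1 - (c i).2) ^ θ))
  | 0, c, _ => by
      rw [Finset.univ_eq_empty, Finset.prod_empty]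
      refine (LiminfGE.of_tendsto tendsto_const_nhds).mono (f := fun _ => 1) ?_
      filter_upwards [eventually_ge_atTop 0] with y hy
      have := card_ball_pos h.nrm_one hy
      simp [boxAverage, boxWeight, this.ne']
  | k + 1, c, hc => by
      have h1 := h.nrm_one
      have ih : LiminfGE (boxAverage S k (Fin.tail c))
          (∏ i : Fin k, ((1 - (c i.succ).1) ^ θ - (1 - (c i.succ).2) ^ θ)) :=
        h.liminfGE_boxAverage hθ k (Fin.tail c) fun i => hc i.succ
      obtain ⟨ha, hab, hb⟩ := hc 0
      rw [Fin.prod_univ_succ]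
      set D := ∏ i : Fin k, ((1 - (c i.succ).1) ^ θ - (1 - (c i.succ).2) ^ θ) with hD
      have hlim : Tendsto (fun t : ℝ => ((1 - (c 0).1) ^ θ - (1 - ((c 0).2 - t)) ^ θ) * (D - t))
          (𝓝[>] 0) (𝓝 (((1 - (c 0).1) ^ θ - (1 - (c 0).2) ^ θ) * D)) := by
        have : ContinuousAt
            (fun t : ℝ => ((1 - (c 0).1) ^ θ - (1 - ((c 0).2 - t)) ^ θ) * (D - t)) 0 := by
          have : ContinuousAt (fun t : ℝ => (1 - ((c 0).2 - t)) ^ θ) 0 :=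
            ContinuousAt.rpow_const (by fun_prop) (Or.inr hθ.le)
          fun_prop
        have := this.tendsto
        simp only [sub_zero] at this
        exact this.mono_left nhdsWithin_le_nhds
      refine LiminfGE.of_tendsto_bound hlim ?_
      filter_upwards [Ioo_mem_nhdsGT (show 0 < (c 0).2 - (c 0).1 by linarith)] with t ⟨ht0, ht⟩
      set b := (c 0).2 - t with hbt
      have hba : (c 0).1 < b := by linarith
      have hb1 : b < 1 := by linarith
      have hpw := h.liminfGE_primeWeight hθ ha hba hb1
      have hfac : 0 ≤ (1 - (c 0).1) ^ θ - (1 - b) ^ θ :=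
        sub_nonneg.2 (Real.rpow_le_rpow (by linarith) (by linarith) hθ.le)
      obtain ⟨T, hT⟩ := eventually_atTop.1 (ih (D - t) (by linarith))
      rcases le_or_gt (D - t) 0 with hD0 | hD0
      · refine (LiminfGE.of_tendsto tendsto_const_nhds).mono (Eventually.of_forall fun y => ?_)
        exact (mul_nonpos_of_nonneg_of_nonpos hfac hD0).trans (boxAverage_nonneg h1 _ _ _)
      · intro x hx
        filter_upwards [hpw (x / (D - t)) (by rwa [div_lt_iff₀ hD0]), eventually_gt_atTop 0,
          eventually_ge_atTop (T / (1 - b))] with y hy hy0 hyT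
        rw [div_lt_iff₀ hD0] at hy
        rw [div_le_iff₀ (by linarith)] at hyT
        refine hy.trans_le (le_trans ?_ (sum_primeInterval_le_boxAverage h1 c hy0.le hb))
        rw [primeWeight, Finset.sum_mul]
        have hterm : ∀ p : S, 0 ≤ logNorm p / y *
            ((ball S (y - logNorm p)).card / (ball S y).card : ℝ) := fun p =>
          mul_nonneg (div_nonneg (logNorm_nonneg h1 p) hy0.le) (by positivity)
        refine (Finset.sum_le_sum fun p hp => ?_).trans
          (Finset.sum_le_sum_of_subset_of_nonneg (fun p hp => ?_) fun p _ _ =>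
            mul_nonneg (hterm p) (boxAverage_nonneg h1 _ _ _))
        · rw [mem_primeInterval] at hp
          exact mul_le_mul_of_nonneg_left (hT _ (by linarith [hp.1.1])).le (hterm p)
        · rw [mem_primeInterval] at hp ⊢
          refine ⟨⟨hp.1.1.trans ?_, hp.1.2⟩, hp.2⟩
          nlinarith

end

end NormedArithmeticSemigroup

namespace PoissonDirichlet

theorem exists_of_lt_ranked {g : ℕ → ℝ} {i : ℕ} {t : ℝ} (h : t < ranked g i) :
    ∃ F : Finset ℕ, F.card = i + 1 ∧ ∀ j ∈ F, t < g j := by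
  have : Nonempty {F : Finset ℕ // F.card = i + 1} := ⟨⟨Finset.range (i + 1), by simp⟩⟩
  obtain ⟨F, hF⟩ := exists_lt_of_lt_ciSup h
  exact ⟨F.1, F.2, (Finset.lt_inf'_iff _).1 hF⟩

theorem lt_ranked {g : ℕ → ℝ} {B : ℝ} (hB : ∀ j, g j ≤ B) {i : ℕ} {t : ℝ} {F : Finset ℕ}
    (hF : F.card = i + 1) (h : ∀ j ∈ F, t < g j) : t < ranked g i := by
  have hne : F.Nonempty := Finset.card_pos.1 (by omega)
  refine ((Finset.lt_inf'_iff hne).2 h).trans_le ?_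
  refine le_ciSup (f := fun F : {F : Finset ℕ // F.card = i + 1} =>
    F.1.inf' (Finset.card_pos.mp (by rw [F.2]; exact i.succ_pos)) g) ⟨B, ?_⟩ ⟨F, hF⟩
  rintro _ ⟨F', rfl⟩
  obtain ⟨j, hj⟩ := Finset.card_pos.mp (show 0 < F'.1.card by rw [F'.2]; exact i.succ_pos)
  exact (Finset.inf'_le g hj).trans (hB j)

end PoissonDirichlet

theorem List.lt_getD_iff_lt_countP {t : ℝ} (ht : 0 ≤ t) :
    ∀ (l : List ℝ), l.Pairwise (· ≥ ·) → ∀ i, t < l.getD i 0 ↔ i < l.countP (fun x => t < x)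
  | [], _, i => by simpa using ht
  | a :: l, hl, i => by
      obtain ⟨ha, hl⟩ := List.pairwise_cons.1 hl
      have ih := List.lt_getD_iff_lt_countP ht l hl
      by_cases hta : t < a
      · rw [List.countP_cons_of_pos (by simpa using hta)]
        cases i with
        | zero => simpa using hta
        | succ i => rw [List.getD_cons_succ, ih]; omega
      · have h0 : l.countP (fun x => t < x) = 0 := by
          rw [List.countP_eq_zero]
          intro x hx
          have := ha x hx
          simp only [decide_eq_true_eq, not_lt] at *
          linarith
        rw [List.countP_cons_of_neg (by simpa using hta), h0]
        cases i with
        | zero => simpa using hta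
        | succ i => rw [List.getD_cons_succ, ih, h0]; omega

namespace NormedArithmeticSemigroup

noncomputable section

open scoped Classical

variable {S : Type*} [NormedArithmeticSemigroup S]

theorem lt_scaledLogFactors_iff {n : ℕ} (hn : 1 < n) (s : S) (i : ℕ) {t : ℝ} (ht : 0 ≤ t) :
    t < scaledLogFactors n s i ↔
      i < (primeFactors s).countP (fun p => t < logNorm p / Real.log n) := by
  have hlog : 0 < Real.log n := Real.log_pos (by exact_mod_cast hn)
  have hmem : ∀ x ∈ factorNorms s, 0 < x := by
    intro x hx
    rw [factorNorms, Multiset.mem_sort] at hx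
    obtain ⟨p, hp, rfl⟩ := Multiset.mem_map.1 hx
    exact one_pos.trans (one_lt_nrm_prime (irreducible_of_mem_primeFactors hp))
  rw [scaledLogFactors, List.lt_getD_iff_lt_countP ht]
  · rw [← Multiset.coe_countP, ← Multiset.map_coe, factorNorms, Multiset.sort_eq,
      Multiset.map_map, Multiset.countP_map, Multiset.countP_eq_card_filter]
    rfl
  · rw [List.pairwise_map]
    have hs : (factorNorms s).Pairwise (· ≥ ·) := Multiset.pairwise_sort _ _
    refine hs.imp_of_mem fun {a b} _ hb hab => ?_
    have := Real.log_le_log (hmem b hb) hab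
    change _ ≤ _
    gcongr

theorem exists_of_boxWeight_ne_zero : ∀ (k : ℕ) (c : Fin k → ℝ × ℝ) (y : ℝ) (M : Multiset S),
    boxWeight k c y M ≠ 0 → ∃ q : ℕ → S, (((List.range k).map q : List S) : Multiset S) ≤ M ∧
      ∀ i : Fin k, (c i).1 * (y - ∑ j ∈ Finset.range i, logNorm (q j)) < logNorm (q i) ∧
        logNorm (q i) ≤ (c i).2 * (y - ∑ j ∈ Finset.range i, logNorm (q j))
  | 0, _, _, M, _ => ⟨fun _ => 1, by simp, fun i => i.elim0⟩
  | k + 1, c, y, M, h => by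
      have : ∃ p ∈ M, (if (c 0).1 * y < logNorm p ∧ logNorm p ≤ (c 0).2 * y then
          logNorm p / (M.map logNorm).sum *
            boxWeight k (Fin.tail c) (y - logNorm p) (M.erase p) else 0) ≠ 0 := by
        by_contra! h0
        refine h ?_
        rw [boxWeight]
        refine Multiset.sum_eq_zero fun x hx => ?_
        obtain ⟨p, hp, rfl⟩ := Multiset.mem_map.1 hx
        exact h0 p hp
      obtain ⟨p, hp, hne⟩ := this
      obtain ⟨hc, hne⟩ := ite_ne_right_iff.1 hne
      obtain ⟨q, hq, hqc⟩ := exists_of_boxWeight_ne_zero k _ _ _ (right_ne_zero_of_mul hne)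
      refine ⟨fun i => Nat.casesOn i p q, ?_, fun i => ?_⟩
      · rw [List.range_succ_eq_map, List.map_cons, List.map_map, ← Multiset.cons_coe,
          ← Multiset.cons_erase hp]
        exact Multiset.cons_le_cons p hq
      · refine Fin.cases ?_ (fun i => ?_) i
        · simpa using hc
        · have := hqc i
          rw [sub_sub, add_comm (logNorm p)] at this
          simp only [Fin.val_succ, Finset.sum_range_succ']
          exact this

/-- The remaining log-norms and the sampled log-norms follow the stick-breaking recursion up to the
mesh of the grid. -/
theorem abs_sub_stick_le {k N : ℕ} {v l : ℕ → ℝ} {y : ℝ} (hy : 0 ≤ y)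
    (hv0 : ∀ i, 0 ≤ v i) (hv1 : ∀ i, v i ≤ 1) (c : Fin k → Fin N)
    (hc : ∀ i : Fin k, (gridInterval N (c i)).1 < 1 - v i ∧ 1 - v i ≤ (gridInterval N (c i)).2)
    (hl : ∀ i : Fin k, (gridInterval N (c i)).1 * (y - ∑ j ∈ Finset.range i, l j) < l i ∧
      l i ≤ (gridInterval N (c i)).2 * (y - ∑ j ∈ Finset.range i, l j)) :
    (∀ i ≤ k, 0 ≤ y - ∑ j ∈ Finset.range i, l j ∧
      |(y - ∑ j ∈ Finset.range i, l j) - (∏ j ∈ Finset.range i, v j) * y| ≤ i / N * y) ∧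
    ∀ i < k, |l i - (∏ j ∈ Finset.range i, v j) * (1 - v i) * y| ≤ k / N * y := by
  set r : ℕ → ℝ := fun i => y - ∑ j ∈ Finset.range i, l j with hr
  set ρ : ℕ → ℝ := fun i => ∏ j ∈ Finset.range i, v j with hρ
  have hrs : ∀ i, r (i + 1) = r i - l i := fun i => by
    simp only [hr, Finset.sum_range_succ]; ring
  have hρs : ∀ i, ρ (i + 1) = ρ i * v i := fun i => Finset.prod_range_succ _ _
  have hgrid : ∀ j : Fin N, 0 ≤ (gridInterval N j).1 ∧ (gridInterval N j).2 ≤ 1 ∧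
      (gridInterval N j).2 = (gridInterval N j).1 + 1 / N := by
    intro j
    have hN : (0 : ℝ) < N := by exact_mod_cast j.pos
    refine ⟨by simp only [gridInterval]; positivity, ?_, by simp only [gridInterval]; ring⟩
    simp only [gridInterval]
    rw [div_le_one hN]
    exact_mod_cast j.2
  have hstep : ∀ i (hi : i < k), 0 ≤ r i → 0 ≤ r (i + 1) ∧ |l i - (1 - v i) * r i| ≤ 1 / N * r i ∧
      r (i + 1) ≤ r i := by
    intro i hi hri
    obtain ⟨h1, h2, h3⟩ := hgrid (c ⟨i, hi⟩)
    obtain ⟨h4, h5⟩ := hc ⟨i, hi⟩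
    obtain ⟨h6, h7⟩ : (gridInterval N (c ⟨i, hi⟩)).1 * r i < l i ∧
      l i ≤ (gridInterval N (c ⟨i, hi⟩)).2 * r i := hl ⟨i, hi⟩
    simp only at h4 h5
    rw [hrs]
    have h8 := mul_le_mul_of_nonneg_right h4.le hri
    have h9 := mul_le_mul_of_nonneg_right h5 hri
    rw [h3, add_mul] at h7 h9
    refine ⟨?_, abs_le.2 ⟨by linarith, by linarith⟩, ?_⟩
    · have := mul_le_mul_of_nonneg_right h2 hri
      rw [h3, add_mul] at this
      linarith
    · have := mul_nonneg h1 hri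
      linarith
  have hmain : ∀ i ≤ k, (0 ≤ r i ∧ |r i - ρ i * y| ≤ i / N * y) ∧ r i ≤ y := by
    intro i
    induction i with
    | zero => intro _; simp [hr, hρ, hy]
    | succ i ih =>
      intro hi
      obtain ⟨⟨h1, h2⟩, h3⟩ := ih (by omega)
      obtain ⟨h4, h5, h6⟩ := hstep i (by omega) h1
      refine ⟨⟨h4, ?_⟩, h6.trans h3⟩
      have e : r (i + 1) - ρ (i + 1) * y =
          v i * (r i - ρ i * y) - (l i - (1 - v i) * r i) := by rw [hrs, hρs]; ring
      rw [e]
      refine (abs_sub _ _).trans ?_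
      rw [abs_mul, abs_of_nonneg (hv0 i)]
      have h7 := mul_le_of_le_one_left (abs_nonneg (r i - ρ i * y)) (hv1 i)
      have h8 : 1 / (N : ℝ) * r i ≤ 1 / N * y := by gcongr
      push_cast
      rw [add_div, add_mul]
      linarith
  refine ⟨fun i hi => (hmain i hi).1, fun i hi => ?_⟩
  obtain ⟨⟨h1, h2⟩, h3⟩ := hmain i hi.le
  obtain ⟨h4, h5, h6⟩ := hstep i hi h1
  have e : l i - ρ i * (1 - v i) * y =
      (1 - v i) * (r i - ρ i * y) + (l i - (1 - v i) * r i) := by ring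
  change |l i - ρ i * (1 - v i) * y| ≤ _
  rw [e]
  refine (abs_add_le _ _).trans ?_
  have hv : 0 ≤ 1 - v i := sub_nonneg.2 (hv1 i)
  rw [abs_mul, abs_of_nonneg hv]
  have h7 := mul_le_of_le_one_left (abs_nonneg (r i - ρ i * y)) (by linarith [hv0 i] : 1 - v i ≤ 1)
  have h8 : 1 / (N : ℝ) * r i ≤ 1 / N * y := by gcongr
  have h9 : ((i : ℝ) + 1) / N * y ≤ k / N * y := by
    have : (i : ℝ) + 1 ≤ k := by exact_mod_cast hi
    gcongr
  rw [add_div, add_mul] at h9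
  linarith

theorem abs_scaledLogFactors_sub_ranked_le (h1 : nrm (1 : S) = 1) {n : ℕ} (hn : 1 < n) {s : S}
    (hs : s ∈ ball S (Real.log n)) {k N : ℕ} {v : ℕ → ℝ} (hv0 : ∀ i, 0 ≤ v i)
    (hv1 : ∀ i, v i ≤ 1) (c : Fin k → Fin N)
    (hc : ∀ i : Fin k, (gridInterval N (c i)).1 < 1 - v i ∧ 1 - v i ≤ (gridInterval N (c i)).2)
    (hw : boxWeight k (fun i => gridInterval N (c i)) (Real.log n) (primeFactors s) ≠ 0)
    {ε : ℝ} (hε : ∏ j ∈ Finset.range k, v j + k / N ≤ ε) (i : ℕ) :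
    |scaledLogFactors n s i -
      PoissonDirichlet.ranked (fun i => (∏ j ∈ Finset.range i, v j) * (1 - v i)) i| ≤ ε := by
  set g : ℕ → ℝ := fun i => (∏ j ∈ Finset.range i, v j) * (1 - v i) with hg
  set y := Real.log n with hydef
  have hy : 0 < y := Real.log_pos (by exact_mod_cast hn)
  obtain ⟨q, hqM, hq⟩ := exists_of_boxWeight_ne_zero k _ _ _ hw
  obtain ⟨hr, hl⟩ := abs_sub_stick_le (l := fun j => logNorm (q j)) hy.le hv0 hv1 c hc hq
  have hρ0 : ∀ j, 0 ≤ ∏ i ∈ Finset.range j, v i := fun j =>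
    Finset.prod_nonneg fun i _ => hv0 i
  have hρanti : Antitone fun j => ∏ i ∈ Finset.range j, v i :=
    antitone_nat_of_succ_le fun j => by
      rw [Finset.prod_range_succ]
      exact mul_le_of_le_one_right (hρ0 j) (hv1 j)
  have hgρ : ∀ j, g j ≤ ∏ i ∈ Finset.range j, v i := fun j =>
    mul_le_of_le_one_right (hρ0 j) (by linarith [hv0 j])
  have hg1 : ∀ j, g j ≤ 1 := fun j => (hgρ j).trans (by simpa using hρanti (Nat.zero_le j))
  have hg0 : ∀ j, 0 ≤ g j := fun j => mul_nonneg (hρ0 j) (sub_nonneg.2 (hv1 j))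
  have hkN : 0 ≤ (k : ℝ) / N := by positivity
  have hclose : ∀ j < k, |logNorm (q j) / y - g j| ≤ k / N := by
    intro j hj
    have := hl j hj
    rw [show logNorm (q j) / y - g j = (logNorm (q j) - g j * y) / y by field_simp, abs_div,
      abs_of_pos hy, div_le_iff₀ hy]
    exact this
  have hcount : ∀ t : ℝ, ((((List.range k).map q : List S) : Multiset S)).countP
      (fun p => t < logNorm p / y) =
        ((Finset.range k).filter fun j => t < logNorm (q j) / y).card := by
    intro t
    rw [← Multiset.map_coe, Multiset.countP_map]
    rfl
  obtain ⟨R, hR⟩ := Multiset.le_iff_exists_add.1 hqM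
  have hrest : ∀ p ∈ R, logNorm p / y ≤ ε := by
    intro p hp
    have e1 := logNorm_eq_sum h1 s
    rw [hR, Multiset.map_add, Multiset.sum_add, Multiset.map_coe, List.map_map,
      Multiset.sum_coe] at e1
    have e2 : ((List.range k).map (logNorm ∘ q)).sum =
        ∑ j ∈ Finset.range k, logNorm (q j) := rfl
    have e3 : logNorm p ≤ (R.map logNorm).sum :=
      Multiset.single_le_sum (by simp [logNorm_nonneg h1]) _ (Multiset.mem_map_of_mem _ hp)
    obtain ⟨-, h3⟩ := hr k le_rfl
    have h4 := (abs_le.1 h3).2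
    have h5 := mem_ball.1 hs
    rw [div_le_iff₀ hy]
    have h6 := mul_le_mul_of_nonneg_right hε hy.le
    rw [add_mul] at h6
    linarith
  have hL0 : ∀ t, 0 ≤ t → (∃ F : Finset ℕ, F.card = i + 1 ∧
      ∀ j ∈ F, j < k ∧ t < logNorm (q j) / y) → t < scaledLogFactors n s i := by
    rintro t ht ⟨F, hF, hF'⟩
    rw [lt_scaledLogFactors_iff hn s i ht, ← Nat.succ_le_iff, Nat.succ_eq_add_one, ← hF]
    refine le_trans ?_ (Multiset.countP_le_of_le _ hqM)
    rw [hcount]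
    refine Finset.card_le_card fun j hj => ?_
    exact Finset.mem_filter.2 ⟨Finset.mem_range.2 (hF' j hj).1, (hF' j hj).2⟩
  have hρk := hρ0 k
  have hnorm : ∀ x ∈ factorNorms s, 1 ≤ x := by
    intro x hx
    rw [factorNorms, Multiset.mem_sort] at hx
    obtain ⟨p, -, rfl⟩ := Multiset.mem_map.1 hx
    exact one_le_nrm h1 p
  have hLnn : 0 ≤ scaledLogFactors n s i := by
    rw [scaledLogFactors]
    rcases lt_or_ge i ((factorNorms s).map fun x => Real.log x / Real.log n).length with h | h
    · rw [List.getD_eq_getElem _ _ h, List.getElem_map]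
      exact div_nonneg (Real.log_nonneg (hnorm _ (List.getElem_mem _))) hy.le
    · rw [List.getD_eq_default _ _ h]
  have hrknn : 0 ≤ PoissonDirichlet.ranked g i := by
    refine le_of_forall_lt fun t ht => ?_
    exact PoissonDirichlet.lt_ranked hg1 (Finset.card_range (i + 1))
      fun j _ => ht.trans_le (hg0 j)
  rw [abs_le]
  constructor
  · by_contra! hlt
    obtain ⟨F, hF, hFt⟩ := PoissonDirichlet.exists_of_lt_ranked
      (show scaledLogFactors n s i + ε < PoissonDirichlet.ranked g i by linarith)
    refine (lt_irrefl _) (hL0 _ hLnn ⟨F, hF, fun j hj => ?_⟩)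
    have hjt := hFt j hj
    have hjk : j < k := by
      by_contra! hkj
      have := (hgρ j).trans (hρanti hkj)
      simp only at this
      linarith
    have := (abs_le.1 (hclose j hjk)).1
    exact ⟨hjk, by linarith⟩
  · by_contra! hlt
    have h2 : PoissonDirichlet.ranked g i + ε < scaledLogFactors n s i := by linarith
    rw [lt_scaledLogFactors_iff hn s i (by linarith), hR, Multiset.countP_add, hcount,
      Multiset.countP_eq_zero.2 fun p hp => by
        have := hrest p hp
        rw [not_lt]
        linarith, add_zero] at h2
    obtain ⟨F, hFsub, hF⟩ := Finset.exists_subset_card_eq (Nat.succ_le_iff.2 h2)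
    refine lt_irrefl _ (PoissonDirichlet.lt_ranked hg1 hF fun j hj => ?_)
    obtain ⟨hjk, hjt⟩ := Finset.mem_filter.1 (hFsub hj)
    have := (abs_le.1 (hclose j (Finset.mem_range.1 hjk))).2
    linarith

end

end NormedArithmeticSemigroup

namespace PoissonDirichlet

theorem uniform_rpow_le {θ : ℝ} (hθ : 0 < θ) {a b : ℝ} (hb : b ≤ 1) :
    uniform {x | a < 1 - x ^ (1 / θ) ∧ 1 - x ^ (1 / θ) ≤ b} ≤
      ENNReal.ofReal ((1 - a) ^ θ - (1 - b) ^ θ) := by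
  rw [uniform, Measure.restrict_apply' measurableSet_Ioo, ← Real.volume_Icc]
  refine measure_mono ?_
  rintro x ⟨⟨h1, h2⟩, hx0, hx1⟩
  have e : x = (x ^ (1 / θ)) ^ θ := by
    rw [← Real.rpow_mul hx0.le, one_div_mul_cancel hθ.ne', Real.rpow_one]
  constructor
  · rw [e]
    exact Real.rpow_le_rpow (by linarith) (by linarith) hθ.le
  · rw [e]
    exact Real.rpow_le_rpow (Real.rpow_nonneg hx0.le _) (by linarith) hθ.le

theorem measure_box_le {θ : ℝ} (hθ : 0 < θ) {k : ℕ} (c : Fin k → ℝ × ℝ)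
    (hc : ∀ i, 0 ≤ (c i).1 ∧ (c i).1 < (c i).2 ∧ (c i).2 ≤ 1) :
    (Measure.infinitePi fun _ : ℕ => uniform)
      {u | ∀ i : Fin k, (c i).1 < 1 - u i ^ (1 / θ) ∧ 1 - u i ^ (1 / θ) ≤ (c i).2} ≤
      ENNReal.ofReal (∏ i, ((1 - (c i).1) ^ θ - (1 - (c i).2) ^ θ)) := by
  let t : ℕ → Set ℝ := fun i =>
    if h : i < k then
      {x | (c ⟨i, h⟩).1 < 1 - x ^ (1 / θ) ∧ 1 - x ^ (1 / θ) ≤ (c ⟨i, h⟩).2}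
    else Set.univ
  have hm : Measurable fun x : ℝ => 1 - x ^ (1 / θ) := by fun_prop
  have ht : ∀ i, MeasurableSet (t i) := by
    intro i
    by_cases h : i < k
    · simp only [t, dif_pos h]
      exact (measurableSet_lt measurable_const hm).inter (measurableSet_le hm measurable_const)
    · simp only [t, dif_neg h]
      exact MeasurableSet.univ
  have e : {u : ℕ → ℝ | ∀ i : Fin k, (c i).1 < 1 - u i ^ (1 / θ) ∧ 1 - u i ^ (1 / θ) ≤ (c i).2} ⊆
      Set.pi (Finset.range k : Finset ℕ) t := by
    intro u hu i hi
    have hi' : i < k := by simpa using hi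
    simp only [t, dif_pos hi']
    exact hu ⟨i, hi'⟩
  refine (measure_mono e).trans ?_
  rw [Measure.infinitePi_pi (μ := fun _ : ℕ => uniform) (fun i _ => ht i),
    Finset.prod_range (fun i => uniform (t i)), ENNReal.ofReal_prod_of_nonneg]
  · refine Finset.prod_le_prod' fun i _ => ?_
    obtain ⟨h1, h2, h3⟩ := hc i
    simp only [t, dif_pos i.2]
    exact uniform_rpow_le hθ h3
  · intro i _
    obtain ⟨h1, h2, h3⟩ := hc i
    exact sub_nonneg.2 (Real.rpow_le_rpow (by linarith) (by linarith) hθ.le)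

theorem ae_mem_Ioo :
    ∀ᵐ u ∂(Measure.infinitePi fun _ : ℕ => uniform), ∀ i, u i ∈ Set.Ioo (0 : ℝ) 1 := by
  rw [ae_all_iff]
  intro i
  have h : ∀ᵐ x ∂uniform, x ∈ Set.Ioo (0 : ℝ) 1 := ae_restrict_mem measurableSet_Ioo
  exact (measurePreserving_eval_infinitePi (fun _ : ℕ => uniform) i).quasiMeasurePreserving.ae h

theorem ae_exists_le_half : ∀ᵐ u ∂(Measure.infinitePi fun _ : ℕ => uniform),
    ∀ m, ∃ i ≥ m, u i ≤ (1 / 2 : ℝ) := by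
  rw [ae_all_iff]
  intro m
  rw [ae_iff]
  have hk : ∀ k : ℕ, (Measure.infinitePi fun _ : ℕ => uniform)
      {u : ℕ → ℝ | ¬∃ i ≥ m, u i ≤ (1 / 2 : ℝ)} ≤ (1 / 2 : ENNReal) ^ k := by
    intro k
    have hsub : {u : ℕ → ℝ | ¬∃ i ≥ m, u i ≤ (1 / 2 : ℝ)} ⊆
        Set.pi (Finset.Ico m (m + k) : Finset ℕ) fun _ => Set.Ioi (1 / 2 : ℝ) := by
      intro u hu i hi
      simp only [Finset.coe_Ico, Set.mem_Ico] at hi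
      by_contra hlt
      exact hu ⟨i, hi.1, not_lt.1 hlt⟩
    refine (measure_mono hsub).trans ?_
    rw [Measure.infinitePi_pi (μ := fun _ : ℕ => uniform) (fun _ _ => measurableSet_Ioi),
      Finset.prod_const, Nat.card_Ico, Nat.add_sub_cancel_left]
    gcongr
    rw [uniform, Measure.restrict_apply' measurableSet_Ioo]
    have hsub' : Set.Ioi (1 / 2 : ℝ) ∩ Set.Ioo 0 1 ⊆ Set.Ioo (1 / 2 : ℝ) 1 :=
      fun x hx => ⟨hx.1, hx.2.2⟩
    refine (measure_mono hsub').trans ?_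
    rw [Real.volume_Ioo, show (1 : ℝ) - 1 / 2 = 1 / 2 by norm_num,
      ENNReal.ofReal_div_of_pos two_pos]
    simp
  have h0 : Tendsto (fun k : ℕ => (1 / 2 : ENNReal) ^ k) atTop (𝓝 0) :=
    ENNReal.tendsto_pow_atTop_nhds_zero_of_lt_one
      (by rw [one_div]; exact ENNReal.inv_lt_one.2 (by norm_num))
  exact le_antisymm (ge_of_tendsto' h0 hk) bot_le

theorem tendsto_prod_zero {v : ℕ → ℝ} (hv0 : ∀ i, 0 ≤ v i) (hv1 : ∀ i, v i ≤ 1) {r : ℝ}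
    (hr0 : 0 ≤ r) (hr1 : r < 1) (h : ∀ m, ∃ i ≥ m, v i ≤ r) :
    Tendsto (fun k => ∏ j ∈ Finset.range k, v j) atTop (𝓝 0) := by
  have hP0 : ∀ j, 0 ≤ ∏ i ∈ Finset.range j, v i := fun j => Finset.prod_nonneg fun i _ => hv0 i
  have hanti : Antitone fun j => ∏ i ∈ Finset.range j, v i :=
    antitone_nat_of_succ_le fun j => by
      rw [Finset.prod_range_succ]
      exact mul_le_of_le_one_right (hP0 j) (hv1 j)
  have hpow : ∀ n : ℕ, ∃ k, ∏ i ∈ Finset.range k, v i ≤ r ^ n := by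
    intro n
    induction n with
    | zero => exact ⟨0, by simp⟩
    | succ n ih =>
      obtain ⟨k, hk⟩ := ih
      obtain ⟨i, hi, hvi⟩ := h k
      refine ⟨i + 1, ?_⟩
      rw [Finset.prod_range_succ, pow_succ]
      exact mul_le_mul ((hanti hi).trans hk) hvi (hv0 i) (pow_nonneg hr0 n)
  rw [Metric.tendsto_atTop]
  intro ε hε
  obtain ⟨n, hn⟩ := exists_pow_lt_of_lt_one hε hr1
  obtain ⟨k, hk⟩ := hpow n
  refine ⟨k, fun j hj => ?_⟩
  rw [Real.dist_eq, sub_zero, abs_of_nonneg (hP0 j)]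
  exact ((hanti hj).trans hk).trans_lt hn

theorem ae_tendsto_prod_zero {θ : ℝ} (hθ : 0 < θ) :
    ∀ᵐ u ∂(Measure.infinitePi fun _ : ℕ => uniform),
      Tendsto (fun k => ∏ j ∈ Finset.range k, u j ^ (1 / θ)) atTop (𝓝 0) := by
  filter_upwards [ae_mem_Ioo, ae_exists_le_half] with u hu hhalf
  have hθ' : 0 < 1 / θ := by positivity
  refine tendsto_prod_zero (r := (1 / 2 : ℝ) ^ (1 / θ)) (fun i => Real.rpow_nonneg (hu i).1.le _)
    (fun i => Real.rpow_le_one (hu i).1.le (hu i).2.le hθ'.le) (by positivity)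
    (Real.rpow_lt_one (by norm_num) (by norm_num) hθ') fun m => ?_
  obtain ⟨i, hi, h⟩ := hhalf m
  exact ⟨i, hi, Real.rpow_le_rpow (hu i).1.le h hθ'.le⟩

end PoissonDirichlet

theorem exists_forall_abs_sub_le_of_isOpen {G : Set (ℕ → ℝ)} (hG : IsOpen G) {r : ℕ → ℝ}
    (hr : r ∈ G) : ∃ ε > 0, ∀ z : ℕ → ℝ, (∀ i, |z i - r i| ≤ ε) → z ∈ G := by
  obtain ⟨I, u, hu, hsub⟩ := isOpen_pi_iff.1 hG r hr
  have : ∀ᶠ ε in 𝓝[>] (0 : ℝ), ∀ i ∈ I, ∀ x, |x - r i| ≤ ε → x ∈ u i := by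
    rw [Filter.eventually_all_finset]
    intro i hi
    obtain ⟨δ, hδ, hball⟩ := Metric.isOpen_iff.1 (hu i hi).1 _ (hu i hi).2
    filter_upwards [Ioo_mem_nhdsGT hδ] with ε hε x hx
    exact hball (by rw [Metric.mem_ball, Real.dist_eq]; exact hx.trans_lt hε.2)
  obtain ⟨ε, h, hε⟩ := (this.and self_mem_nhdsWithin).exists
  exact ⟨ε, hε, fun z hz => hsub fun i hi => h i hi _ (hz i)⟩

namespace NormedArithmeticSemigroup

noncomputable section

open scoped Classical

theorem exists_gridInterval {N : ℕ} (hN : 0 < N) {w : ℝ} (hw0 : 0 < w) (hw1 : w ≤ 1) :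
    ∃ j : Fin N, (gridInterval N j).1 < w ∧ w ≤ (gridInterval N j).2 := by
  have hN' : (0 : ℝ) < N := by exact_mod_cast hN
  have hpos : 0 < ⌈w * N⌉₊ := Nat.ceil_pos.2 (by positivity)
  have hle : ⌈w * N⌉₊ ≤ N := Nat.ceil_le.2 (by nlinarith)
  have hcast : ((⌈w * N⌉₊ - 1 : ℕ) : ℝ) = (⌈w * N⌉₊ : ℝ) - 1 := by
    rw [Nat.cast_sub hpos, Nat.cast_one]
  refine ⟨⟨⌈w * N⌉₊ - 1, by omega⟩, ?_, ?_⟩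
  · simp only [gridInterval, hcast]
    rw [div_lt_iff₀ hN']
    have := Nat.ceil_lt_add_one (show 0 ≤ w * N by positivity)
    linarith
  · simp only [gridInterval, hcast]
    rw [le_div_iff₀ hN', sub_add_cancel]
    exact Nat.le_ceil _

theorem gridInterval_mem (N : ℕ) (j : Fin N) : 0 ≤ (gridInterval N j).1 ∧
    (gridInterval N j).1 < (gridInterval N j).2 ∧ (gridInterval N j).2 ≤ 1 := by
  have hN : (0 : ℝ) < N := by exact_mod_cast j.pos
  simp only [gridInterval]
  refine ⟨by positivity, ?_, ?_⟩
  · gcongr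
    linarith
  · rw [div_le_one hN]
    exact_mod_cast j.2

variable {S : Type*} [NormedArithmeticSemigroup S]

/-- The boxes of the grid such that sampling in the box forces the scaled log-factors into `G`. -/
def goodBoxes (S : Type*) [NormedArithmeticSemigroup S] (G : Set (ℕ → ℝ)) (k N : ℕ) :
    Finset (Fin k → Fin N) :=
  Finset.univ.filter fun c => ∀ n : ℕ, 1 < n → ∀ s ∈ ball S (Real.log n),
    boxWeight k (fun i => gridInterval N (c i)) (Real.log n) (primeFactors s) ≠ 0 →
      scaledLogFactors n s ∈ G

theorem toFinset_finite_nrm_le (h1 : nrm (1 : S) = 1) {n : ℕ} (hn : 1 < n) :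
    (finite_nrm_le (S := S) n).toFinset = ball S (Real.log n) := by
  ext s
  have hn' : (0 : ℝ) < n := by exact_mod_cast (one_pos.trans hn)
  rw [mem_ball, logNorm, Real.log_le_log_iff (one_pos.trans_le (one_le_nrm h1 s)) hn']
  simp

theorem sum_boxAverage_le_law (h1 : nrm (1 : S) = 1) {G : Set (ℕ → ℝ)} (hG : MeasurableSet G)
    (k N : ℕ) (n : Set.Ioi (1 : ℕ)) :
    ENNReal.ofReal (∑ c ∈ goodBoxes S G k N,
      boxAverage S k (fun i => gridInterval N (c i)) (Real.log (n : ℕ))) ≤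
      (scaledLogFactorsLaw S n : Measure (ℕ → ℝ)) G := by
  have hn : 1 < (n : ℕ) := n.2
  have hy : 0 ≤ Real.log (n : ℕ) := Real.log_natCast_nonneg _
  have hlaw : (scaledLogFactorsLaw S n : Measure (ℕ → ℝ)) G =
      ((ball S (Real.log (n : ℕ))).filter fun s => scaledLogFactors n s ∈ G).card /
        (ball S (Real.log (n : ℕ))).card := by
    change (PMF.map _ _).toMeasure G = _
    rw [PMF.toMeasure_apply_eq_toOuterMeasure_apply _ hG, PMF.toOuterMeasure_map_apply]
    refine (PMF.toOuterMeasure_uniformOfFinset_apply _ _).trans ?_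
    simp only [toFinset_finite_nrm_le h1 hn, Set.mem_preimage]
  have hN := card_ball_pos h1 hy
  rw [hlaw, ← ENNReal.ofReal_natCast, ← ENNReal.ofReal_natCast (ball S _).card,
    ← ENNReal.ofReal_div_of_pos hN]
  refine ENNReal.ofReal_le_ofReal ?_
  simp only [boxAverage]
  rw [← Finset.sum_div]
  refine div_le_div_of_nonneg_right ?_ hN.le
  rw [Finset.sum_comm, Finset.card_filter, Nat.cast_sum]
  refine Finset.sum_le_sum fun s hs => ?_
  by_cases hsG : scaledLogFactors n s ∈ G
  · rw [if_pos hsG, Nat.cast_one]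
    exact (Finset.sum_le_sum_of_subset_of_nonneg (Finset.subset_univ _)
      fun c _ _ => boxWeight_nonneg h1 _ _ _ _).trans (sum_boxWeight_le_one h1 N k _ _)
  · rw [if_neg hsG, Nat.cast_zero]
    refine (Finset.sum_eq_zero fun c hc => ?_).le
    by_contra hne
    exact hsG ((Finset.mem_filter.1 hc).2 n hn s hs hne)

theorem RegularGrowth.le_liminf_law {θ : ℝ} (h : RegularGrowth S θ) (hθ : 0 < θ)
    {G : Set (ℕ → ℝ)} (hG : MeasurableSet G) (k N : ℕ) :
    ENNReal.ofReal (∑ c ∈ goodBoxes S G k N,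
      ∏ i, ((1 - (gridInterval N (c i)).1) ^ θ - (1 - (gridInterval N (c i)).2) ^ θ)) ≤
      liminf (fun n => (scaledLogFactorsLaw S n : Measure (ℕ → ℝ)) G) atTop := by
  have hlim : LiminfGE (fun y => ∑ c ∈ goodBoxes S G k N,
      boxAverage S k (fun i => gridInterval N (c i)) y) (∑ c ∈ goodBoxes S G k N,
      ∏ i, ((1 - (gridInterval N (c i)).1) ^ θ - (1 - (gridInterval N (c i)).2) ^ θ)) :=
    LiminfGE.sum _ fun c _ => h.liminfGE_boxAverage hθ k _ fun i => gridInterval_mem N (c i)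
  have hlog : Tendsto (fun n : Set.Ioi (1 : ℕ) => Real.log (n : ℕ)) atTop atTop :=
    tendsto_comp_val_Ioi_atTop (f := fun n : ℕ => Real.log n).2
      (Real.tendsto_log_atTop.comp tendsto_natCast_atTop_atTop)
  refine le_of_forall_lt fun x hx => ?_
  obtain ⟨z, hxz, hz⟩ := exists_between hx
  refine hxz.trans_le (le_liminf_of_le (by isBoundedDefault) ?_)
  have hzr := (ENNReal.lt_ofReal_iff_toReal_lt hz.ne_top).1 hz
  filter_upwards [hlog.eventually (hlim _ hzr)] with n hn
  exact ((ENNReal.ofReal_toReal hz.ne_top).symm.le.trans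
    (ENNReal.ofReal_le_ofReal hn.le)).trans (sum_boxAverage_le_law h.nrm_one hG k N n)

theorem RegularGrowth.tendsto_law {θ : ℝ} (h : RegularGrowth S θ) (hθ : 0 < θ) :
    Tendsto (scaledLogFactorsLaw S) atTop (𝓝 (PoissonDirichlet.PD θ)) := by
  refine tendsto_of_forall_isOpen_le_liminf' fun G hG => ?_
  set X := liminf (fun n => (scaledLogFactorsLaw S n : Measure (ℕ → ℝ)) G) atTop
  let μ : Measure (ℕ → ℝ) := Measure.infinitePi fun _ : ℕ => PoissonDirichlet.uniform
  let A : ℕ → Set (ℕ → ℝ) := fun k => ⋃ c ∈ goodBoxes S G k ((k + 1) ^ 2),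
    {u | ∀ i : Fin k, (gridInterval ((k + 1) ^ 2) (c i)).1 < 1 - u i ^ (1 / θ) ∧
      1 - u i ^ (1 / θ) ≤ (gridInterval ((k + 1) ^ 2) (c i)).2}
  have hA : ∀ k, μ (A k) ≤ X := by
    intro k
    refine le_trans ?_ (h.le_liminf_law hθ hG.measurableSet k ((k + 1) ^ 2))
    rw [ENNReal.ofReal_sum_of_nonneg]
    · exact (measure_biUnion_finset_le _ _).trans (Finset.sum_le_sum fun c _ =>
        PoissonDirichlet.measure_box_le hθ _ fun i => gridInterval_mem _ (c i))
    · intro c _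
      refine Finset.prod_nonneg fun i _ => ?_
      obtain ⟨h1, h2, h3⟩ := gridInterval_mem _ (c i)
      exact sub_nonneg.2 (Real.rpow_le_rpow (by linarith) (by linarith) hθ.le)
  have hPD : (PoissonDirichlet.PD θ : Measure (ℕ → ℝ)) G =
      μ ((fun u => PoissonDirichlet.ranked (PoissonDirichlet.stickBreaking θ u)) ⁻¹' G) := by
    exact Measure.map_apply (PoissonDirichlet.measurable_ranked.comp
      (PoissonDirichlet.measurable_stickBreaking θ)) hG.measurableSet
  have hB : Monotone fun K => ⋂ k ≥ K, A k := fun K K' hK =>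
    Set.biInter_subset_biInter_left fun k hk => le_trans hK hk
  have hae : ∀ᵐ u ∂μ,
      u ∈ (fun u => PoissonDirichlet.ranked (PoissonDirichlet.stickBreaking θ u)) ⁻¹' G →
        u ∈ ⋃ K, ⋂ k ≥ K, A k := by
    filter_upwards [PoissonDirichlet.ae_mem_Ioo, PoissonDirichlet.ae_tendsto_prod_zero hθ]
      with u hu hprod huG
    have hθ' : 0 < 1 / θ := by positivity
    have hv0 : ∀ i, 0 < u i ^ (1 / θ) := fun i => Real.rpow_pos_of_pos (hu i).1 _
    have hv1 : ∀ i, u i ^ (1 / θ) < 1 := fun i => Real.rpow_lt_one (hu i).1.le (hu i).2 hθ'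
    obtain ⟨ε, hε, hεG⟩ := exists_forall_abs_sub_le_of_isOpen hG huG
    have hsmall : Tendsto (fun k : ℕ => ∏ j ∈ Finset.range k, u j ^ (1 / θ) +
        1 / ((k : ℝ) + 1)) atTop (𝓝 (0 + 0)) := hprod.add tendsto_one_div_add_atTop_nhds_zero_nat
    rw [add_zero] at hsmall
    obtain ⟨K, hK⟩ := eventually_atTop.1 (hsmall.eventually (gt_mem_nhds hε))
    refine Set.mem_iUnion.2 ⟨K, Set.mem_iInter₂.2 fun k hk => ?_⟩
    have hexists := fun i : Fin k => exists_gridInterval (N := (k + 1) ^ 2) (by positivity)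
      (sub_pos.2 (hv1 i)) (by linarith [hv0 i] : 1 - u i ^ (1 / θ) ≤ 1)
    choose c hc using hexists
    refine Set.mem_iUnion₂.2 ⟨c, Finset.mem_filter.2 ⟨Finset.mem_univ _, ?_⟩, hc⟩
    intro n hn s hs hw
    refine hεG _ fun i => abs_scaledLogFactors_sub_ranked_le h.nrm_one hn hs
      (fun i => (hv0 i).le) (fun i => (hv1 i).le) c hc hw ?_ i
    refine le_trans (add_le_add le_rfl ?_) (hK k hk).le
    push_cast
    rw [div_le_div_iff₀ (by positivity) (by positivity)]
    nlinarith [Nat.cast_nonneg (α := ℝ) k]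
  rw [hPD]
  have hle : μ ((fun u => PoissonDirichlet.ranked (PoissonDirichlet.stickBreaking θ u)) ⁻¹' G) ≤
      μ (⋃ K, ⋂ k ≥ K, A k) := measure_mono_ae hae
  refine hle.trans ?_
  rw [hB.measure_iUnion]
  exact iSup_le fun K => (measure_mono (Set.iInter₂_subset K le_rfl)).trans (hA K)

end

end NormedArithmeticSemigroup

theorem theorem5p3 {S : Type*} [NormedArithmeticSemigroup S] :
    (NormedArithmeticSemigroup.LinearGrowth S →
      Tendsto (NormedArithmeticSemigroup.scaledLogFactorsLaw S) atTop
        (𝓝 (PoissonDirichlet.PD 1))) ∧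
    ∀ θ : ℝ, 0 < θ → NormedArithmeticSemigroup.PrimeGrowth S θ →
      Tendsto (NormedArithmeticSemigroup.scaledLogFactorsLaw S) atTop
        (𝓝 (PoissonDirichlet.PD θ)) :=
  ⟨fun h => (NormedArithmeticSemigroup.regularGrowth_of_linearGrowth h).tendsto_law one_pos,
    fun _ hθ h => (NormedArithmeticSemigroup.regularGrowth_of_primeGrowth hθ h).tendsto_law hθ⟩
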